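/- Let $\mathbb N_0=\{0,1,2,\dots\}$ and $\mathfrak H=\ell^2(\mathbb N_0,L^2(\mathbb R))$; elements of $\mathfrak H$ are written $U\sim\{u_n\}_{n\in\mathbb N_0}$. (Expansion in the normalized Hermite functions in the variable $q$ identifies $L^2(\mathbb R^2)$ with $\mathfrak H$.) **Operators $\mathbf A_0$ and $\mathbf A_\alpha$.** Let $\operatorname{Dom}\mathbf A_0$ be the set of all $U\sim\{u_n\}\in\mathfrak H$ with $u_n\in H^2(\mathbb R)$ for every $n$ and $\sum_n\|-u_n''+(n+\tfrac12)u_n\|^2<\infty$, and let $\mathbf A_0U\sim\{-u_n''+(n+\tfrac12)u_n\}$. For $\alpha>0$ put $\mu=\sqrt2/\alpha$ and let $\operatorname{Dom}\mathbf A_\alpha$ be the set of all $U\sim\{u_n\}\in\mathfrak H$ such that every $u_n$ is continuous on $\mathbb R$ with $u_n|_{\mathbb R_\pm}\in H^2(\mathbb R_\pm)$, the matching conditions $$\mu\bigl(u_n'(0+)-u_n'(0-)\bigr)=\sqrt{n+1}\,u_{n+1}(0)+\sqrt n\,u_{n-1}(0),\qquad n\in\mathbb N_0,$$ hold (the last term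 being absent for $n=0$), and $\sum_n\|-u_n''+(n+\tfrac12)u_n\|^2<\infty$, where $u_n''$ is taken on $\mathbb R\setminus\{0\}$; on this domain $\mathbf A_\alpha U\sim\{-u_n''+(n+\tfrac12)u_n\}$. **Auxiliary objects.** For $\lambda\in\mathbb C\setminus\mathbb R$ let $\zeta_n(\lambda)=\sqrt{n+\tfrac12-\lambda}$ with $\operatorname{Re}\zeta_n(\lambda)>0$, $\eta_n(x;\lambda)=(n+\tfrac12)^{1/4}e^{-\zeta_n(\lambda)|x|}$, $y_n(\lambda)=(n+\tfrac12)^{1/2}\zeta_n(\lambda)$ and $d_n=n^{1/2}(n^2-\tfrac14)^{1/4}$ (so $d_0=0$). Let $\mathbf T(\lambda):\ell^2(\mathbb N_0)\to\mathfrak H$ be the bounded operator $\mathbf T(\lambda)\{X_n\}\sim\{X_n\eta_n(\cdot;\lambda)\}$, and let $\mathrm Y(\lambda)$ be the operator of multiplication by $\{y_n(\lambda)\}$ in $\ell^2(\mathbb N_0)$, on its maximal domain. Let $\mathcal J_0(\mu)$ be the closure in $\ell^2(\mathbb N_0)$ of the operator $$\{X_n\}\mapsto\{d_nX_{n-1}+2\mu(n+\tfrac12)X_n+d_{n+1}X_{n+1}\}$$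 on sequences with finitely many non-zero terms, and let $\mathcal J(\lambda;\mu)$ be the operator $$\{X_n\}\mapsto\{d_nX_{n-1}+2\mu\,y_n(\lambda)X_n+d_{n+1}X_{n+1}\}$$ on the domain $\operatorname{Dom}\mathcal J(\lambda;\mu)=\operatorname{Dom}\mathcal J_0(\mu)$. **Theorem.** Let $\alpha>0$, $\mu=\sqrt2/\alpha$ and $\lambda\in\mathbb C\setminus\mathbb R$. Then the operators $\mathbf A_\alpha-\lambda$, $\mathbf A_0-\lambda$, $\mathcal J(\lambda;\mu)$ and $2\mathrm Y(\lambda)$ have bounded, everywhere defined inverses, and $$(\mathbf A_\alpha-\lambda)^{-1}-(\mathbf A_0-\lambda)^{-1}=\mathbf T(\lambda)\bigl(\mu\,\mathcal J(\lambda;\mu)^{-1}-(2\mathrm Y(\lambda))^{-1}\bigr)\mathbf T(\overline\lambda)^*.$$ -/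

import Mathlib

noncomputable section

open MeasureTheory Set Filter Topology
open scoped ContDiff ENNReal ComplexConjugate

namespace Smilansky

/-! ### Sobolev spaces on open subsets of the line, through weak derivatives -/

/-- `v` is the weak derivative of `u` on the open set `Ω ⊆ ℝ`. -/
def HasWeakDeriv (Ω : Set ℝ) (u v : ℝ → ℂ) : Prop :=
  ∀ φ : ℝ → ℝ, ContDiff ℝ ∞ φ → HasCompactSupport φ → tsupport φ ⊆ Ω →
    ∫ x in Ω, deriv φ x • u x = -∫ x in Ω, φ x • v x

/-- `u ∈ H²(Ω)`, and `g` is its second weak derivative on `Ω`. -/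
def IsH2With (Ω : Set ℝ) (u g : ℝ → ℂ) : Prop :=
  MemLp u 2 (volume.restrict Ω) ∧ MemLp g 2 (volume.restrict Ω) ∧
    ∃ p : ℝ → ℂ, MemLp p 2 (volume.restrict Ω) ∧ HasWeakDeriv Ω u p ∧ HasWeakDeriv Ω p g

/-- `u` belongs to `𝓦(ℝ)`, that is, `u ∈ C(ℝ)` and the restrictions of `u` to both open half-lines
are of class `H²`; `g` is the second derivative of `u` off the origin. -/
def IsWWith (u g : ℝ → ℂ) : Prop :=
  Continuous u ∧ IsH2With (Iio 0) u g ∧ IsH2With (Ioi 0) u g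

/-- `u'(0+) - u'(0-) = j`. A function in `𝓦(ℝ)` is continuously differentiable on each closed
half-line, so the one-sided limits of the derivative are the one-sided derivatives at `0`. -/
def HasDerivJump (u : ℝ → ℂ) (j : ℂ) : Prop :=
  ∃ a b : ℂ, HasDerivWithinAt u a (Ioi 0) 0 ∧ HasDerivWithinAt u b (Iio 0) 0 ∧ j = a - b

theorem integrable_test_smul {Ω : Set ℝ} {u : ℝ → ℂ} (hu : MemLp u 2 (volume.restrict Ω))
    {φ : ℝ → ℝ} (hφ : Continuous φ) (hc : HasCompactSupport φ) :
    Integrable (fun x => φ x • u x) (volume.restrict Ω) := by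
  have h : MemLp φ 2 (volume.restrict Ω) := hφ.memLp_of_hasCompactSupport hc
  exact memLp_one_iff_integrable.1 (hu.smul h)

theorem HasWeakDeriv.add {Ω : Set ℝ} {u v u' v' : ℝ → ℂ}
    (hu : MemLp u 2 (volume.restrict Ω)) (hv : MemLp v 2 (volume.restrict Ω))
    (hu' : MemLp u' 2 (volume.restrict Ω)) (hv' : MemLp v' 2 (volume.restrict Ω))
    (h : HasWeakDeriv Ω u v) (h' : HasWeakDeriv Ω u' v') :
    HasWeakDeriv Ω (u + u') (v + v') := by
  intro φ hφ hc hs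
  have hd : Continuous (deriv φ) := hφ.continuous_deriv (by simp)
  simp only [Pi.add_apply, smul_add]
  rw [integral_add (integrable_test_smul hu hd hc.deriv) (integrable_test_smul hu' hd hc.deriv),
    integral_add (integrable_test_smul hv hφ.continuous hc)
      (integrable_test_smul hv' hφ.continuous hc), h φ hφ hc hs, h' φ hφ hc hs]
  ring

theorem HasWeakDeriv.smul {Ω : Set ℝ} {u v : ℝ → ℂ} (c : ℂ)
    (h : HasWeakDeriv Ω u v) : HasWeakDeriv Ω (c • u) (c • v) := by
  intro φ hφ hc hs
  simp only [Pi.smul_apply]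
  simp only [smul_comm _ c]
  rw [integral_smul, integral_smul, h φ hφ hc hs, smul_neg]

theorem IsH2With.add {Ω : Set ℝ} {u g u' g' : ℝ → ℂ} (h : IsH2With Ω u g)
    (h' : IsH2With Ω u' g') : IsH2With Ω (u + u') (g + g') := by
  obtain ⟨hu, hg, p, hp, h1, h2⟩ := h
  obtain ⟨hu', hg', p', hp', h1', h2'⟩ := h'
  exact ⟨hu.add hu', hg.add hg', p + p', hp.add hp', h1.add hu hp hu' hp' h1',
    h2.add hp hg hp' hg' h2'⟩

theorem IsH2With.smul {Ω : Set ℝ} {u g : ℝ → ℂ} (c : ℂ) (h : IsH2With Ω u g) :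
    IsH2With Ω (c • u) (c • g) := by
  obtain ⟨hu, hg, p, hp, h1, h2⟩ := h
  exact ⟨hu.const_smul c, hg.const_smul c, c • p, hp.const_smul c, h1.smul c, h2.smul c⟩

theorem HasWeakDeriv.congr_ae {Ω : Set ℝ} {u v u' : ℝ → ℂ} (h : HasWeakDeriv Ω u v)
    (huu' : u =ᵐ[volume.restrict Ω] u') : HasWeakDeriv Ω u' v := by
  intro φ hφ hc hs
  rw [← h φ hφ hc hs]
  apply integral_congr_ae
  filter_upwards [huu'] with x hx
  rw [hx]

theorem IsH2With.congr_ae {Ω : Set ℝ} {u g u' : ℝ → ℂ} (h : IsH2With Ω u g)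
    (huu' : u =ᵐ[volume.restrict Ω] u') : IsH2With Ω u' g := by
  obtain ⟨hu, hg, p, hp, h1, h2⟩ := h
  exact ⟨(memLp_congr_ae huu').1 hu, hg, p, hp, h1.congr_ae huu', h2⟩

theorem HasWeakDeriv.ae_zero {Ω : Set ℝ} (hΩ : IsOpen Ω) {u v : ℝ → ℂ}
    (hv : MemLp v 2 (volume.restrict Ω)) (h : HasWeakDeriv Ω u v)
    (hu : u =ᵐ[volume.restrict Ω] 0) : v =ᵐ[volume.restrict Ω] 0 := by
  have key : ∀ᵐ x ∂volume, x ∈ Ω → v x = 0 := by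
    apply hΩ.ae_eq_zero_of_integral_contDiff_smul_eq_zero
    · exact locallyIntegrableOn_of_locallyIntegrable_restrict (hv.locallyIntegrable (by norm_num))
    · intro φ hφ hc hs
      have h0 := h φ hφ hc hs
      have h1 : ∫ x in Ω, deriv φ x • u x = 0 := by
        apply integral_eq_zero_of_ae
        filter_upwards [hu] with x hx
        simp [hx]
      rw [h1, eq_comm, neg_eq_zero, setIntegral_eq_integral_of_forall_compl_eq_zero] at h0
      · exact h0
      · intro x hx
        rw [image_eq_zero_of_notMem_tsupport (fun hx' => hx (hs hx')), zero_smul]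
  exact (ae_restrict_iff' hΩ.measurableSet).2 key

theorem IsH2With.ae_zero {Ω : Set ℝ} (hΩ : IsOpen Ω) {u g : ℝ → ℂ} (h : IsH2With Ω u g)
    (hu : u =ᵐ[volume.restrict Ω] 0) : g =ᵐ[volume.restrict Ω] 0 := by
  obtain ⟨-, hg, p, hp, h1, h2⟩ := h
  exact h2.ae_zero hΩ hg (h1.ae_zero hΩ hp hu)

theorem IsWWith.add {u g u' g' : ℝ → ℂ} (h : IsWWith u g) (h' : IsWWith u' g') :
    IsWWith (u + u') (g + g') :=
  ⟨h.1.add h'.1, h.2.1.add h'.2.1, h.2.2.add h'.2.2⟩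

theorem IsWWith.smul {u g : ℝ → ℂ} (c : ℂ) (h : IsWWith u g) : IsWWith (c • u) (c • g) :=
  ⟨h.1.const_smul c, h.2.1.smul c, h.2.2.smul c⟩

theorem IsWWith.ae_zero {u g : ℝ → ℂ} (h : IsWWith u g) (hu : u =ᵐ[volume] 0) :
    g =ᵐ[volume] 0 := by
  have h1 := h.2.1.ae_zero isOpen_Iio (ae_restrict_of_ae hu)
  have h2 := h.2.2.ae_zero isOpen_Ioi (ae_restrict_of_ae hu)
  have h3 : ∀ᵐ x : ℝ, x ≠ 0 := Measure.ae_ne volume 0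
  filter_upwards [(ae_restrict_iff' measurableSet_Iio).1 h1,
    (ae_restrict_iff' measurableSet_Ioi).1 h2, h3] with x hx1 hx2 hx3
  rcases lt_or_gt_of_ne hx3 with hx | hx
  · exact hx1 hx
  · exact hx2 hx

/-! ### The differential operators -/

/-- The Hilbert space `ℓ²(ℕ₀)`. -/
abbrev ell2 : Type := lp (fun _ : ℕ => ℂ) 2

/-- The Hilbert space `L²(ℝ)`. -/
abbrev L2R : Type := Lp ℂ 2 (volume : Measure ℝ)

/-- The Hilbert space `𝓗 = ℓ²(ℕ₀, L²(ℝ))`. -/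
abbrev GH : Type := lp (fun _ : ℕ => L2R) 2

/-- The graph of `A₀`: all components of `U` lie in `H²(ℝ)` and `V = {(-d²/dx² + 1/2 + n) uₙ}`. -/
def graphA0 : Submodule ℂ (GH × GH) where
  carrier := {P | ∃ g : ℕ → ℝ → ℂ, ∀ n : ℕ,
    IsH2With univ (P.1 n : ℝ → ℂ) (g n) ∧
    (P.2 n : ℝ → ℂ) =ᵐ[volume] fun x => -g n x + ((n : ℂ) + 1 / 2) * (P.1 n : ℝ → ℂ) x}
  zero_mem' := by
    refine ⟨fun _ => 0, fun n => ⟨?_, ?_⟩⟩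
    · have h : IsH2With univ (0 : ℝ → ℂ) 0 := by
        refine ⟨MemLp.zero, MemLp.zero, 0, MemLp.zero, ?_, ?_⟩ <;> intro φ _ _ _ <;> simp
      refine h.congr_ae (ae_restrict_of_ae ?_)
      exact (Lp.coeFn_zero ℂ 2 volume).symm
    · filter_upwards [Lp.coeFn_zero ℂ 2 (volume : Measure ℝ)] with x hx
      change (0 : L2R) x = -0 + _ * (0 : L2R) x
      rw [hx]
      simp
  add_mem' := by
    rintro ⟨U, V⟩ ⟨U', V'⟩ ⟨g, hg⟩ ⟨g', hg'⟩
    refine ⟨fun n => g n + g' n, fun n => ⟨?_, ?_⟩⟩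
    · refine ((hg n).1.add (hg' n).1).congr_ae (ae_restrict_of_ae ?_)
      exact (Lp.coeFn_add (U n) (U' n)).symm
    · filter_upwards [Lp.coeFn_add (U n) (U' n), Lp.coeFn_add (V n) (V' n), (hg n).2,
        (hg' n).2] with x h1 h2 h3 h4
      change (V n + V' n : L2R) x = -(g n x + g' n x) + _ * (U n + U' n : L2R) x
      rw [h1, h2, Pi.add_apply, Pi.add_apply, h3, h4]
      ring
  smul_mem' := by
    rintro c ⟨U, V⟩ ⟨g, hg⟩
    refine ⟨fun n => c • g n, fun n => ⟨?_, ?_⟩⟩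
    · refine ((hg n).1.smul c).congr_ae (ae_restrict_of_ae ?_)
      exact (Lp.coeFn_smul c (U n)).symm
    · filter_upwards [Lp.coeFn_smul c (U n), Lp.coeFn_smul c (V n), (hg n).2] with x h1 h2 h3
      change (c • V n : L2R) x = -(c * g n x) + _ * (c • U n : L2R) x
      rw [h1, h2, Pi.smul_apply, Pi.smul_apply, h3, smul_eq_mul, smul_eq_mul]
      ring

theorem graphA0_functional : ∀ P ∈ graphA0, P.1 = 0 → P.2 = 0 := by
  rintro ⟨U, V⟩ ⟨g, hg⟩ hU
  replace hU : U = 0 := hU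
  subst hU
  change V = 0
  ext1
  funext n
  have h0 : ((0 : L2R) : ℝ → ℂ) =ᵐ[volume] 0 := Lp.coeFn_zero ℂ 2 volume
  have h1 : g n =ᵐ[volume] 0 := by
    have := (hg n).1.ae_zero isOpen_univ (ae_restrict_of_ae h0)
    rwa [Measure.restrict_univ] at this
  apply Lp.ext
  filter_upwards [h0, h1, (hg n).2] with x hx0 hx1 hx2
  change (V n : ℝ → ℂ) x = (0 : L2R) x
  rw [hx2, hx1, hx0]
  change -(0 : ℂ) + _ * (0 : L2R) x = 0
  rw [hx0]
  simp

/-- The unperturbed operator `A₀`. -/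
def opA0 : GH →ₗ.[ℂ] GH := graphA0.toLinearPMap

theorem opA0_graph : opA0.graph = graphA0 :=
  Submodule.toLinearPMap_graph_eq _ graphA0_functional

/-- The graph of `A_α`, `α > 0`, with `μ = √2 / α`: the components `uₙ` of `U` lie in `𝓦(ℝ)`,
satisfy the matching conditions
`μ (uₙ'(0+) - uₙ'(0-)) = √(n+1) uₙ₊₁(0) + √n uₙ₋₁(0)`, and `V = {-uₙ'' + (n + 1/2) uₙ}`
(`uₙ''` being taken off the origin). For `n = 0` the term with `uₙ₋₁` has coefficient zero. -/
def graphA (α : ℝ) : Submodule ℂ (GH × GH) where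
  carrier := {P | ∃ u g : ℕ → ℝ → ℂ, ∀ n : ℕ,
    (P.1 n : ℝ → ℂ) =ᵐ[volume] u n ∧ IsWWith (u n) (g n) ∧
    (∃ j : ℂ, HasDerivJump (u n) j ∧
      ((√2 / α : ℝ) : ℂ) * j =
        (√((n : ℝ) + 1) : ℂ) * u (n + 1) 0 + (√(n : ℝ) : ℂ) * u (n - 1) 0) ∧
    (P.2 n : ℝ → ℂ) =ᵐ[volume] fun x => -g n x + ((n : ℂ) + 1 / 2) * u n x}
  zero_mem' := by
    refine ⟨fun _ => 0, fun _ => 0, fun n => ⟨Lp.coeFn_zero ℂ 2 volume, ?_, ⟨0, ?_, ?_⟩, ?_⟩⟩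
    · have h : ∀ Ω, IsH2With Ω (0 : ℝ → ℂ) 0 := by
        intro Ω
        refine ⟨MemLp.zero, MemLp.zero, 0, MemLp.zero, ?_, ?_⟩ <;> intro φ _ _ _ <;> simp
      exact ⟨continuous_zero, h _, h _⟩
    · exact ⟨0, 0, hasDerivWithinAt_const _ _ _, hasDerivWithinAt_const _ _ _, by simp⟩
    · simp
    · filter_upwards [Lp.coeFn_zero ℂ 2 (volume : Measure ℝ)] with x hx
      change (0 : L2R) x = _
      rw [hx]
      simp
  add_mem' := by
    rintro ⟨U, V⟩ ⟨U', V'⟩ ⟨u, g, h⟩ ⟨u', g', h'⟩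
    refine ⟨fun n => u n + u' n, fun n => g n + g' n, fun n => ?_⟩
    obtain ⟨h1, h2, ⟨j, ⟨a, b, ha, hb, hj⟩, hm⟩, h3⟩ := h n
    obtain ⟨h1', h2', ⟨j', ⟨a', b', ha', hb', hj'⟩, hm'⟩, h3'⟩ := h' n
    refine ⟨(Lp.coeFn_add (U n) (U' n)).trans (h1.add h1'), h2.add h2',
      ⟨j + j', ⟨a + a', b + b', ha.add ha', hb.add hb', ?_⟩, ?_⟩, ?_⟩
    · rw [hj, hj']; ring
    · rw [mul_add, hm, hm']
      simp only [Pi.add_apply]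
      ring
    · filter_upwards [Lp.coeFn_add (V n) (V' n), h3, h3'] with x hx1 hx2 hx3
      change (V n + V' n : L2R) x = -(g n x + g' n x) + _ * (u n x + u' n x)
      rw [hx1, Pi.add_apply, hx2, hx3]
      ring
  smul_mem' := by
    rintro c ⟨U, V⟩ ⟨u, g, h⟩
    refine ⟨fun n => c • u n, fun n => c • g n, fun n => ?_⟩
    obtain ⟨h1, h2, ⟨j, ⟨a, b, ha, hb, hj⟩, hm⟩, h3⟩ := h n
    refine ⟨(Lp.coeFn_smul c (U n)).trans (h1.const_smul c), h2.smul c,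
      ⟨c * j, ⟨c * a, c * b, ha.const_mul c, hb.const_mul c, ?_⟩, ?_⟩, ?_⟩
    · rw [hj]; ring
    · rw [mul_left_comm, hm]
      simp only [Pi.smul_apply, smul_eq_mul]
      ring
    · filter_upwards [Lp.coeFn_smul c (V n), h3] with x hx1 hx2
      change (c • V n : L2R) x = -(c * g n x) + _ * (c * u n x)
      rw [hx1, Pi.smul_apply, hx2, smul_eq_mul]
      ring

theorem graphA_functional (α : ℝ) : ∀ P ∈ graphA α, P.1 = 0 → P.2 = 0 := by
  rintro ⟨U, V⟩ ⟨u, g, h⟩ hU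
  replace hU : U = 0 := hU
  subst hU
  change V = 0
  ext1
  funext n
  obtain ⟨h1, h2, -, h3⟩ := h n
  have h0 : ((0 : L2R) : ℝ → ℂ) =ᵐ[volume] 0 := Lp.coeFn_zero ℂ 2 volume
  have hu : u n =ᵐ[volume] 0 := h1.symm.trans h0
  apply Lp.ext
  filter_upwards [h0, hu, h2.ae_zero hu, h3] with x hx0 hx1 hx2 hx3
  change (V n : ℝ → ℂ) x = (0 : L2R) x
  rw [hx3, hx2, hx1, hx0]
  simp

/-- The operator `A_α`, `α > 0`. -/
def opA (α : ℝ) : GH →ₗ.[ℂ] GH := (graphA α).toLinearPMap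

theorem opA_graph (α : ℝ) : (opA α).graph = graphA α :=
  Submodule.toLinearPMap_graph_eq _ (graphA_functional α)

/-! ### The functions `ζₙ`, `ηₙ` and the operator `T(Λ)` -/

/-- `ζₙ(Λ) = √(n + 1/2 - Λ)`, principal branch. -/
def zeta (Λ : ℂ) (n : ℕ) : ℂ := ((n : ℂ) + 1 / 2 - Λ) ^ (2⁻¹ : ℂ)

/-- `ηₙ(x; Λ) = (n + 1/2)^{1/4} exp(-ζₙ(Λ)|x|)`. -/
def eta (Λ : ℂ) (n : ℕ) (x : ℝ) : ℂ :=
  ((((n : ℝ) + 1 / 2) ^ (1 / 4 : ℝ) : ℝ) : ℂ) * Complex.exp (-zeta Λ n * (|x| : ℝ))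

theorem zeta_sq (Λ : ℂ) (n : ℕ) : zeta Λ n ^ 2 = (n : ℂ) + 1 / 2 - Λ := by
  have := Complex.cpow_nat_inv_pow ((n : ℂ) + 1 / 2 - Λ) (n := 2) two_ne_zero
  rw [zeta]; exact_mod_cast this

theorem zeta_re (Λ : ℂ) (n : ℕ) : (zeta Λ n).re =
    √((‖(n : ℂ) + 1 / 2 - Λ‖ + ((n : ℝ) + 1 / 2 - Λ.re)) / 2) := by
  rw [zeta, Complex.cpow_inv_two_re]
  congr 3
  simp

theorem zeta_re_nonneg (Λ : ℂ) (n : ℕ) : 0 ≤ (zeta Λ n).re := by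
  rw [zeta_re]; positivity

theorem exists_zeta_bound {Λ : ℂ} (hΛ : Λ.im ≠ 0) :
    ∃ C : ℝ, 0 < C ∧ ∀ n : ℕ, (n : ℝ) + 1 / 2 ≤ C ^ 2 * (zeta Λ n).re ^ 2 := by
  set M : ℝ := 3 * |Λ.re| + |Λ.im| with hM
  have him : 0 < |Λ.im| := abs_pos.2 hΛ
  have hre : 0 ≤ |Λ.re| := abs_nonneg _
  have hMpos : 0 < M := by positivity
  refine ⟨2 + 2 * M / |Λ.im|, by positivity, fun n => ?_⟩
  have hn : (0 : ℝ) ≤ n := n.cast_nonneg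
  set r : ℝ := (n : ℝ) + 1 / 2 - Λ.re with hr
  set N : ℝ := ‖(n : ℂ) + 1 / 2 - Λ‖ with hN
  have hNsq : N ^ 2 = r ^ 2 + Λ.im ^ 2 := by
    rw [hN, Complex.sq_norm, Complex.normSq_apply]
    simp [hr]
    ring
  have hN0 : 0 ≤ N := norm_nonneg _
  have hrN : |r| ≤ N := abs_le_of_sq_le_sq (by nlinarith [sq_nonneg Λ.im]) hN0
  have hz : (zeta Λ n).re ^ 2 = (N + r) / 2 := by
    rw [zeta_re, Real.sq_sqrt]
    have := neg_abs_le r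
    change 0 ≤ (N + r) / 2
    linarith
  rw [hz]
  have hNr : 0 ≤ (N + r) / 2 := by rw [← hz]; positivity
  by_cases hc : 2 * |Λ.re| ≤ (n : ℝ) + 1 / 2
  · have h1 : ((n : ℝ) + 1 / 2) / 2 ≤ r := by
      have := le_abs_self Λ.re
      rw [hr]; linarith
    have h2 : r ≤ (N + r) / 2 := by linarith [le_abs_self r]
    have h3 : (4 : ℝ) ≤ (2 + 2 * M / |Λ.im|) ^ 2 := by
      have : 0 ≤ 2 * M / |Λ.im| := by positivity
      nlinarith
    nlinarith
  · push Not at hc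
    have hrM : |r| ≤ 3 * |Λ.re| := by
      rw [hr, abs_le]
      have h1 := le_abs_self Λ.re
      have h2 := neg_abs_le Λ.re
      constructor <;> linarith
    have hNM : N ≤ M := by
      apply le_of_sq_le_sq _ hMpos.le
      rw [hNsq, ← sq_abs r, ← sq_abs Λ.im, hM]
      nlinarith [abs_nonneg r]
    have hprod : (N + r) * (N - r) = |Λ.im| ^ 2 := by rw [sq_abs]; linarith
    have hle : N - r ≤ 2 * M := by
      have := neg_abs_le r
      linarith
    have hkey : |Λ.im| ^ 2 ≤ (N + r) * (2 * M) := by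
      rw [← hprod]
      exact mul_le_mul_of_nonneg_left hle (by linarith)
    have h4 : (2 * M / |Λ.im|) ^ 2 ≤ (2 + 2 * M / |Λ.im|) ^ 2 := by
      have : 0 ≤ 2 * M / |Λ.im| := by positivity
      nlinarith
    have h5 : M ≤ (2 * M / |Λ.im|) ^ 2 * ((N + r) / 2) := by
      rw [div_pow, div_mul_eq_mul_div, le_div_iff₀ (by positivity)]
      nlinarith
    have h6 : (n : ℝ) + 1 / 2 ≤ M := by rw [hM]; linarith
    calc (n : ℝ) + 1 / 2 ≤ M := h6
      _ ≤ _ := h5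
      _ ≤ _ := mul_le_mul_of_nonneg_right h4 hNr

theorem zeta_re_pos {Λ : ℂ} (hΛ : Λ.im ≠ 0) (n : ℕ) : 0 < (zeta Λ n).re := by
  obtain ⟨C, hC, h⟩ := exists_zeta_bound hΛ
  refine lt_of_le_of_ne (zeta_re_nonneg Λ n) fun h0 => ?_
  have := h n
  rw [← h0] at this
  have hn : (0 : ℝ) ≤ n := n.cast_nonneg
  norm_num at this
  linarith

theorem norm_eta_sq (Λ : ℂ) (n : ℕ) (x : ℝ) :
    ‖eta Λ n x‖ ^ 2 = √((n : ℝ) + 1 / 2) * Real.exp (-(2 * (zeta Λ n).re) * |x|) := by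
  have hn : (0 : ℝ) ≤ (n : ℝ) + 1 / 2 := by positivity
  rw [eta, norm_mul, mul_pow, Complex.norm_exp, Complex.norm_real, Real.norm_eq_abs, sq_abs,
    ← Real.rpow_natCast, ← Real.rpow_mul hn, Real.sqrt_eq_rpow, ← Real.exp_nat_mul]
  congr 2
  · norm_num
  · rw [Complex.re_mul_ofReal, Complex.neg_re]
    push_cast
    ring

theorem integrable_norm_eta_sq {Λ : ℂ} (hΛ : Λ.im ≠ 0) (n : ℕ) :
    Integrable (fun x => ‖eta Λ n x‖ ^ 2) := by
  simp only [norm_eta_sq]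
  have hz := zeta_re_pos hΛ n
  apply Integrable.const_mul
  rw [← integrableOn_univ, ← Iic_union_Ioi (a := (0 : ℝ))]
  apply IntegrableOn.union
  · refine (integrableOn_exp_mul_Iic (a := 2 * (zeta Λ n).re) (by linarith) 0).congr_fun ?_
      measurableSet_Iic
    intro x hx
    simp only [abs_of_nonpos (mem_Iic.1 hx)]
    ring_nf
  · refine (integrableOn_exp_mul_Ioi (a := -(2 * (zeta Λ n).re)) (by linarith) 0).congr_fun ?_
      measurableSet_Ioi
    intro x hx
    simp only [abs_of_pos (mem_Ioi.1 hx)]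

theorem integral_norm_eta_sq {Λ : ℂ} (hΛ : Λ.im ≠ 0) (n : ℕ) :
    ∫ x, ‖eta Λ n x‖ ^ 2 = √((n : ℝ) + 1 / 2) / (zeta Λ n).re := by
  simp only [norm_eta_sq]
  have hz := zeta_re_pos hΛ n
  rw [integral_const_mul, integral_comp_abs (f := fun x => Real.exp (-(2 * (zeta Λ n).re) * x)),
    integral_exp_mul_Ioi (by linarith)]
  field_simp
  simp

theorem continuous_eta (Λ : ℂ) (n : ℕ) : Continuous (eta Λ n) := by
  unfold eta; fun_prop

theorem memLp_eta {Λ : ℂ} (hΛ : Λ.im ≠ 0) (n : ℕ) : MemLp (eta Λ n) 2 (volume : Measure ℝ) :=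
  (memLp_two_iff_integrable_sq_norm (continuous_eta Λ n).aestronglyMeasurable).2
    (integrable_norm_eta_sq hΛ n)

/-- `ηₙ(·; Λ)` as an element of `L²(ℝ)`. -/
def etaLp {Λ : ℂ} (hΛ : Λ.im ≠ 0) (n : ℕ) : L2R := (memLp_eta hΛ n).toLp

theorem exists_etaLp_bound {Λ : ℂ} (hΛ : Λ.im ≠ 0) :
    ∃ C : ℝ, 0 ≤ C ∧ ∀ n, ‖etaLp hΛ n‖ ≤ C := by
  obtain ⟨C, hC, h⟩ := exists_zeta_bound hΛ
  refine ⟨√C, by positivity, fun n => ?_⟩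
  have hz := zeta_re_pos hΛ n
  apply Real.le_sqrt_of_sq_le
  have h1 : ‖etaLp hΛ n‖ ^ 2 = ∫ x, ‖eta Λ n x‖ ^ 2 := by
    rw [← @inner_self_eq_norm_sq ℂ, L2.inner_def, ← integral_re (L2.integrable_inner _ _)]
    apply integral_congr_ae
    filter_upwards [(memLp_eta hΛ n).coeFn_toLp] with x hx
    rw [inner_self_eq_norm_sq, etaLp, hx]
  rw [h1, integral_norm_eta_sq hΛ, div_le_iff₀ hz]
  apply Real.sqrt_le_iff.2
  exact ⟨by positivity, by rw [mul_pow]; exact h n⟩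

theorem memℓp_smul_of_bound {E : Type*} [NormedAddCommGroup E] [NormedSpace ℂ E] {X : ℕ → ℂ}
    (hX : Memℓp X 2) {e : ℕ → E} {C : ℝ} (he : ∀ n, ‖e n‖ ≤ C) :
    Memℓp (fun n => X n • e n) 2 := by
  refine (hX.const_smul (C : ℂ)).mono' fun n => ?_
  have hC : 0 ≤ C := (norm_nonneg _).trans (he n)
  rw [norm_smul, Pi.smul_apply, norm_smul, Complex.norm_real, Real.norm_of_nonneg hC, mul_comm]
  exact mul_le_mul_of_nonneg_right (he n) (norm_nonneg _)

/-- The bounded operator `T(Λ) : ℓ²(ℕ₀) → 𝓗`, `{Xₙ} ↦ {Xₙ ηₙ(·; Λ)}`, for non-real `Λ`. -/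
def opT {Λ : ℂ} (hΛ : Λ.im ≠ 0) : ell2 →L[ℂ] GH :=
  LinearMap.mkContinuousOfExistsBound
    { toFun := fun X => ⟨fun n => X n • etaLp hΛ n, by
        obtain ⟨C, -, h⟩ := exists_etaLp_bound hΛ
        exact memℓp_smul_of_bound (lp.memℓp X) h⟩
      map_add' := fun X Z => lp.ext (funext fun n => add_smul (X n) (Z n) (etaLp hΛ n))
      map_smul' := fun c X => lp.ext (funext fun n => mul_smul c (X n) (etaLp hΛ n)) } (by
    obtain ⟨C, hC, h⟩ := exists_etaLp_bound hΛ
    refine ⟨C, fun X => ?_⟩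
    have h1 : ‖(C : ℂ) • X‖ = C * ‖X‖ := by
      rw [norm_smul, Complex.norm_real, Real.norm_of_nonneg hC]
    rw [← h1]
    refine lp.norm_mono (by norm_num) fun n => ?_
    change ‖X n • etaLp hΛ n‖ ≤ ‖(C : ℂ) * X n‖
    rw [norm_smul, norm_mul, Complex.norm_real, Real.norm_of_nonneg hC, mul_comm]
    exact mul_le_mul_of_nonneg_right (h n) (norm_nonneg _))

theorem opT_apply {Λ : ℂ} (hΛ : Λ.im ≠ 0) (X : ell2) (n : ℕ) :
    (opT hΛ X n : ℝ → ℂ) =ᵐ[volume] fun x => X n * eta Λ n x := by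
  change ((X n • etaLp hΛ n : L2R) : ℝ → ℂ) =ᵐ[volume] _
  filter_upwards [Lp.coeFn_smul (X n) (etaLp hΛ n), (memLp_eta hΛ n).coeFn_toLp] with x h1 h2
  rw [h1, Pi.smul_apply, etaLp, h2, smul_eq_mul]

/-! ### Jacobi matrices -/

/-- `dₙ = n^{1/2} (n² - 1/4)^{1/4}`; in particular `d₀ = 0`. -/
def dcoef (n : ℕ) : ℝ := √(n : ℝ) * ((n : ℝ) ^ 2 - 1 / 4) ^ (1 / 4 : ℝ)

/-- `yₙ(Λ) = (n + 1/2)^{1/2} ζₙ(Λ)`. -/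
def ycoef (Λ : ℂ) (n : ℕ) : ℂ := (√((n : ℝ) + 1 / 2) : ℂ) * zeta Λ n

/-- The action of the Jacobi matrix `D S + S* D + 𝒟{ωₙ}` on sequences, where `D = 𝒟{dₙ}` and
`S` is the forward shift: `(J X)ₙ = dₙ Xₙ₋₁ + dₙ₊₁ Xₙ₊₁ + ωₙ Xₙ`. As `d₀ = 0`, the first term is
absent for `n = 0`. -/
def jacobiAction (w : ℕ → ℂ) (X : ℕ → ℂ) (n : ℕ) : ℂ :=
  (dcoef n : ℂ) * X (n - 1) + (dcoef (n + 1) : ℂ) * X (n + 1) + w n * X n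

theorem jacobiAction_add (w X Z : ℕ → ℂ) :
    jacobiAction w (X + Z) = jacobiAction w X + jacobiAction w Z := by
  funext n
  simp only [jacobiAction, Pi.add_apply]
  ring

theorem jacobiAction_smul (w : ℕ → ℂ) (c : ℂ) (X : ℕ → ℂ) :
    jacobiAction w (c • X) = c • jacobiAction w X := by
  funext n
  simp only [jacobiAction, Pi.smul_apply, smul_eq_mul]
  ring

/-- Sequences in `ℓ²(ℕ₀)` with finitely many non-zero terms. -/
def finiteSeq : Submodule ℂ ell2 where
  carrier := {X | (Function.support fun n => X n).Finite}
  zero_mem' := by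
    simp [Function.support]
  add_mem' := by
    intro X Z hX hZ
    refine (hX.union hZ).subset fun n hn => ?_
    by_contra h
    simp only [mem_union, Function.mem_support, not_or, not_not] at h
    exact hn (by simp [h.1, h.2])
  smul_mem' := by
    intro c X hX
    refine hX.subset fun n hn h => hn ?_
    have h' : X n = 0 := h
    have h2 : (c • X) n = c * X n := rfl
    exact h2.trans (by rw [h', mul_zero])

/-- The Jacobi operator `D S + S* D + 𝒟{ωₙ}` on finite sequences. -/
def jacobiMin (w : ℕ → ℂ) : ell2 →ₗ.[ℂ] ell2 where
  domain := finiteSeq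
  toFun :=
    { toFun := fun X => ⟨jacobiAction w (X : ell2), by
        refine (memℓp_zero ?_).of_exponent_ge zero_le
        have h : (Function.support fun n => (X : ell2) n).Finite := X.2
        obtain ⟨N, hN⟩ := h.bddAbove
        refine (finite_Iic (N + 1)).subset fun n hn => ?_
        by_contra hlt
        rw [mem_Iic, not_le] at hlt
        have hz : ∀ m, N < m → (X : ell2) m = 0 := fun m hm => by
          by_contra h0
          exact absurd (hN h0) (not_le.2 hm)
        refine hn ?_
        rw [jacobiAction, hz (n - 1) (by omega), hz (n + 1) (by omega), hz n (by omega)]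
        simp⟩
      map_add' := fun X Z => lp.ext (jacobiAction_add w (X : ell2) (Z : ell2))
      map_smul' := fun c X => lp.ext (jacobiAction_smul w c (X : ell2)) }

/-- `J₀(μ) = D S + S* D + 2 μ Y₀`, `Y₀ = 𝒟{n + 1/2}`: the closure of the operator on finite
sequences (which is essentially self-adjoint). -/
def opJ0 (μ : ℝ) : ell2 →ₗ.[ℂ] ell2 :=
  (jacobiMin fun n => 2 * (μ : ℂ) * ((n : ℂ) + 1 / 2)).closure

theorem continuous_coord (n : ℕ) : Continuous fun X : ell2 => X n :=
  (lp.lipschitzWith_one_eval 2 n).continuous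

theorem closure_graph_jacobiMin (w : ℕ → ℂ) (P : ell2 × ell2)
    (hP : P ∈ (jacobiMin w).graph.topologicalClosure) (n : ℕ) :
    P.2 n = jacobiAction w P.1 n := by
  have hcl : IsClosed {P : ell2 × ell2 | P.2 n = jacobiAction w P.1 n} := by
    have hc := continuous_coord
    refine isClosed_eq ((hc n).comp continuous_snd) ?_
    have h1 := (hc (n - 1)).comp (continuous_fst (X := ell2) (Y := ell2))
    have h2 := (hc (n + 1)).comp (continuous_fst (X := ell2) (Y := ell2))
    have h3 := (hc n).comp (continuous_fst (X := ell2) (Y := ell2))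
    exact ((continuous_const.mul h1).add (continuous_const.mul h2)).add (continuous_const.mul h3)
  refine closure_minimal ?_ hcl hP
  intro Q hQ
  obtain ⟨X, hX1, hX2⟩ := (LinearPMap.mem_graph_iff _).1 hQ
  change Q.2 n = jacobiAction w Q.1 n
  rw [← hX1, ← hX2]
  rfl

theorem jacobiMin_isClosable (w : ℕ → ℂ) : (jacobiMin w).IsClosable := by
  refine ⟨(jacobiMin w).graph.topologicalClosure.toLinearPMap, ?_⟩
  rw [Submodule.toLinearPMap_graph_eq]
  intro P hP h0
  refine lp.ext (funext fun n => ?_)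
  rw [closure_graph_jacobiMin w P hP n, h0]
  simp [jacobiAction]

theorem opJ0_apply (μ : ℝ) (X : (opJ0 μ).domain) (n : ℕ) :
    opJ0 μ X n = jacobiAction (fun n => 2 * (μ : ℂ) * ((n : ℂ) + 1 / 2)) (X : ell2) n := by
  have h := (opJ0 μ).mem_graph X
  have hg := (jacobiMin_isClosable
    fun n => 2 * (μ : ℂ) * ((n : ℂ) + 1 / 2)).graph_closure_eq_closure_graph
  change _ = (opJ0 μ).graph at hg
  rw [← hg] at h
  exact closure_graph_jacobiMin _ _ h n

theorem norm_ycoef_sub_le (Λ : ℂ) (n : ℕ) : ‖ycoef Λ n - ((n : ℂ) + 1 / 2)‖ ≤ ‖Λ‖ := by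
  have hn : (0 : ℝ) < (n : ℝ) + 1 / 2 := by positivity
  set s : ℝ := √((n : ℝ) + 1 / 2) with hs
  have hspos : 0 < s := Real.sqrt_pos.2 hn
  have hss : (s : ℂ) ^ 2 = (n : ℂ) + 1 / 2 := by
    rw [← Complex.ofReal_pow, hs, Real.sq_sqrt hn.le]
    push_cast
    ring
  have hden : s ≤ ‖zeta Λ n + s‖ := by
    refine le_trans ?_ (Complex.re_le_norm _)
    simpa using zeta_re_nonneg Λ n
  have hne : zeta Λ n + s ≠ 0 := norm_pos_iff.1 (hspos.trans_le hden)
  have heq : (ycoef Λ n - ((n : ℂ) + 1 / 2)) * (zeta Λ n + s) = -(s * Λ) := by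
    rw [ycoef, ← hss]
    linear_combination (s : ℂ) * zeta_sq Λ n - (s : ℂ) * hss
  have hnorm := congrArg norm heq
  rw [norm_mul, norm_neg, norm_mul, Complex.norm_real, Real.norm_of_nonneg hspos.le] at hnorm
  have h2 : ‖ycoef Λ n - ((n : ℂ) + 1 / 2)‖ * s ≤ s * ‖Λ‖ := by
    rw [← hnorm]
    exact mul_le_mul_of_nonneg_left hden (norm_nonneg _)
  nlinarith

/-- `J(Λ; μ) = D S + S* D + 2 μ Y(Λ)`, `Y(Λ) = 𝒟{yₙ(Λ)}`, on the domain of `J₀(μ)`. -/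
def opJ (Λ : ℂ) (μ : ℝ) : ell2 →ₗ.[ℂ] ell2 where
  domain := (opJ0 μ).domain
  toFun :=
    { toFun := fun X => ⟨jacobiAction (fun n => 2 * (μ : ℂ) * ycoef Λ n) (X : ell2), by
        have h1 : Memℓp (fun n => opJ0 μ X n) 2 := lp.memℓp _
        have h2 := (memℓp_smul_of_bound (lp.memℓp (X : ell2))
          (norm_ycoef_sub_le Λ)).const_smul (2 * (μ : ℂ))
        have h3 : jacobiAction (fun n => 2 * (μ : ℂ) * ycoef Λ n) (X : ell2) =
            (fun n => opJ0 μ X n) + (2 * (μ : ℂ)) •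
              fun n => (X : ell2) n • (ycoef Λ n - ((n : ℂ) + 1 / 2)) := by
          funext n
          simp only [opJ0_apply, Pi.add_apply, Pi.smul_apply, smul_eq_mul, jacobiAction]
          ring
        rw [h3]
        exact h1.add h2⟩
      map_add' := fun X Z => lp.ext (jacobiAction_add _ (X : ell2) (Z : ell2))
      map_smul' := fun c X => lp.ext (jacobiAction_smul _ c (X : ell2)) }

/-- The diagonal operator `𝒟{ωₙ}` in `ℓ²(ℕ₀)`, on its maximal domain. -/
def opDiag (w : ℕ → ℂ) : ell2 →ₗ.[ℂ] ell2 where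
  domain :=
    { carrier := {X | Memℓp (fun n => w n * X n) 2}
      zero_mem' := by
        simpa using (zero_mem_ℓp' : Memℓp (fun _ : ℕ => (0 : ℂ)) 2)
      add_mem' := by
        intro X Z hX hZ
        have h : (fun n => w n * (X + Z) n) = (fun n => w n * X n) + fun n => w n * Z n :=
          funext fun n => mul_add (w n) (X n) (Z n)
        exact (congrArg (Memℓp · 2) h).mpr (hX.add hZ)
      smul_mem' := by
        intro c X hX
        have h : (fun n => w n * (c • X) n) = c • fun n => w n * X n :=
          funext fun n => mul_left_comm (w n) c (X n)
        exact (congrArg (Memℓp · 2) h).mpr (hX.const_smul c) }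
  toFun :=
    { toFun := fun X => ⟨fun n => w n * (X : ell2) n, X.2⟩
      map_add' := fun X Z => lp.ext (funext fun n =>
        mul_add (w n) ((X : ell2) n) ((Z : ell2) n))
      map_smul' := fun c X => lp.ext (funext fun n => mul_left_comm (w n) c ((X : ell2) n)) }

/-- `Y(Λ) = 𝒟{yₙ(Λ)}`. -/
def opY (Λ : ℂ) : ell2 →ₗ.[ℂ] ell2 := opDiag (ycoef Λ)

/-! ### Inverses of unbounded operators -/

/-- `A - z`, on the domain of `A`. -/
def shiftOp {E : Type*} [AddCommGroup E] [Module ℂ E] (A : E →ₗ.[ℂ] E) (z : ℂ) : E →ₗ.[ℂ] E where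
  domain := A.domain
  toFun := A.toFun - z • A.domain.subtype

/-- `B = A⁻¹`, where `B` is bounded and everywhere defined: `A` is a bijection of its domain onto
the whole space, with inverse `B`. -/
def IsBoundedInverse {E : Type*} [NormedAddCommGroup E] [NormedSpace ℂ E]
    (A : E →ₗ.[ℂ] E) (B : E →L[ℂ] E) : Prop :=
  (∀ f : E, ∃ h : B f ∈ A.domain, A ⟨B f, h⟩ = f) ∧ ∀ u : A.domain, B (A u) = u

theorem im_conj_ne_zero {Λ : ℂ} (hΛ : Λ.im ≠ 0) : (conj Λ).im ≠ 0 := by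
  simpa using hΛ

end Smilansky

end

noncomputable section

open MeasureTheory Set Filter Topology
open scoped ContDiff ENNReal ComplexConjugate

namespace Smilansky

/-! ### Jacobi matrices with a definite imaginary part -/

/-! The right-hand side of the formula, added to `R₀ = (A₀ - Λ)⁻¹`, is taken as a candidate and
shown to invert `A_α - Λ`. Write `q_n = (n + 1/2)^{1/4}`. The `n`-th component of `R₀ f` is the free
solution `w_n`, the convolution of `f_n` with `exp (-ζ_n |x|) / (2 ζ_n)`, and the kernel at `x = 0`
is proportional to `η_n`, so `(T(Λ̄)* f)_n = 2 ζ_n q_n w_n(0)`. Every continuous solution of `-u'' +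
ζ_n² u = f_n` that is piecewise `H²` with a kink at the origin has the form `w_n + X_n η_n`, with
trace `w_n(0) + X_n q_n` and jump `-2 ζ_n q_n X_n`. With `F = T(Λ̄)* f`, `Z = J⁻¹ F` and `X = μ Z -
(2Y)⁻¹ F`, the trace is `μ Z_n q_n`. Since `d_{n+1} = √(n+1) q_n q_{n+1}`, the matching condition
times `q_n` is `μ` times the `n`-th row of `J Z = F` (`isBoundedInverse_opA`). Conversely, a
solution of `A_α U = Λ U` equals `T X` with `X` in `ℓ²` annihilated by the Jacobi matrix, so `U = 0`
(`opA_eq_zero`).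

The analytic core is the invertibility of `J(Λ; μ)`. The numbers `Im y_n(Λ)` have one sign and stay
away from zero (`exists_le_im_ycoef`), while `d_n ≤ n`. In the imaginary part of a truncated pairing
`⟨X, J X⟩` only one edge term survives, and it cannot stay away from zero for square-summable `X`
because the harmonic series diverges (`norm_le_of_jacobiAction`). So the Jacobi matrix is bounded
below on its maximal domain, for `Λ` and for `Λ̄`. This gives closed range and, by orthogonality,
dense range (`exists_inverse_opJ`); essential self-adjointness of `J₀(μ)` is never invoked.

On the line, the free resolvent is built from convolutions with one-sided exponentials, and
uniqueness comes from factoring `u'' = s² u` into two first-order equations, solved weakly with an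
integrating factor. -/

theorem dcoef_zero : dcoef 0 = 0 := by simp [dcoef]

theorem dcoef_nonneg (n : ℕ) : 0 ≤ dcoef n := by
  rcases Nat.eq_zero_or_pos n with rfl | hn
  · rw [dcoef_zero]
  · have h1 : (1 : ℝ) ≤ n := by exact_mod_cast hn
    have h2 : (0 : ℝ) ≤ (n : ℝ) ^ 2 - 1 / 4 := by nlinarith
    unfold dcoef
    positivity

/-- Linear growth of the off-diagonal is Carleman's condition: the reciprocals of the weights
dominate the harmonic series. -/
theorem dcoef_le (n : ℕ) : dcoef n ≤ n := by
  rcases Nat.eq_zero_or_pos n with rfl | hn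
  · simp [dcoef_zero]
  · have h1 : (1 : ℝ) ≤ n := by exact_mod_cast hn
    have h2 : (0 : ℝ) ≤ (n : ℝ) ^ 2 - 1 / 4 := by nlinarith
    have h3 : ((n : ℝ) ^ 2 - 1 / 4) ^ (1 / 4 : ℝ) ≤ √n := by
      calc ((n : ℝ) ^ 2 - 1 / 4) ^ (1 / 4 : ℝ) ≤ ((n : ℝ) ^ 2) ^ (1 / 4 : ℝ) :=
            Real.rpow_le_rpow h2 (by linarith) (by norm_num)
        _ = √n := by
            rw [Real.sqrt_eq_rpow, ← Real.rpow_natCast, ← Real.rpow_mul (by positivity)]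
            norm_num
    calc dcoef n ≤ √n * √n := mul_le_mul_of_nonneg_left h3 (Real.sqrt_nonneg _)
      _ = n := Real.mul_self_sqrt (by positivity)

/-- The difference of squares under the fourth root splits into the factors that normalize `η_n` and
`η_{n+1}`. -/
theorem dcoef_succ (n : ℕ) : dcoef (n + 1) =
    √((n : ℝ) + 1) * ((n : ℝ) + 1 / 2) ^ (1 / 4 : ℝ) * ((n : ℝ) + 3 / 2) ^ (1 / 4 : ℝ) := by
  rw [dcoef, mul_assoc, ← Real.mul_rpow (by positivity) (by positivity)]
  push_cast
  ring_nf

/-- The off-diagonal part is real and symmetric, so neighbouring indices contribute conjugate terms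
whose imaginary parts cancel. Only the edge from `N` to `N + 1` is cut by the truncation; at the
left end `d₀ = 0`. -/
theorem sum_im_conj_mul_jacobiAction (w X : ℕ → ℂ) (N : ℕ) :
    ∑ n ∈ Finset.range (N + 1), (conj (X n) * jacobiAction w X n).im =
      ∑ n ∈ Finset.range (N + 1), (w n).im * ‖X n‖ ^ 2 +
        dcoef (N + 1) * (conj (X N) * X (N + 1)).im := by
  induction N with
  | zero =>
    simp only [zero_add, Finset.sum_range_one, jacobiAction, dcoef_zero, Complex.sq_norm,
      Complex.normSq_apply]
    simp
    ring
  | succ N ih =>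
    rw [Finset.sum_range_succ, ih, Finset.sum_range_succ _ (N + 1)]
    simp only [jacobiAction, Complex.sq_norm, Complex.normSq_apply, Nat.add_sub_cancel]
    simp
    ring

/-! ### Norms and truncated pairings in `ℓ²(ℕ₀)`. -/

theorem ell2_summable_sq (X : ell2) : Summable fun n => ‖X n‖ ^ 2 := by
  have := (lp.memℓp X).summable (by norm_num)
  simpa using this

theorem ell2_norm_sq (X : ell2) : ‖X‖ ^ 2 = ∑' n, ‖X n‖ ^ 2 := by
  have := lp.norm_rpow_eq_tsum (p := 2) (by norm_num) X
  simpa using this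

theorem sum_range_im_le (X V : ell2) (N : ℕ) :
    |∑ n ∈ Finset.range N, (conj (X n) * V n).im| ≤ ‖X‖ * ‖V‖ := by
  calc |∑ n ∈ Finset.range N, (conj (X n) * V n).im|
      ≤ ∑ n ∈ Finset.range N, ‖X n‖ * ‖V n‖ := by
        refine (Finset.abs_sum_le_sum_abs _ _).trans (Finset.sum_le_sum fun n _ => ?_)
        refine (Complex.abs_im_le_norm _).trans ?_
        rw [norm_mul, RCLike.norm_conj]
    _ ≤ √(∑ n ∈ Finset.range N, ‖X n‖ ^ 2) * √(∑ n ∈ Finset.range N, ‖V n‖ ^ 2) :=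
        Real.sum_mul_le_sqrt_mul_sqrt _ _ _
    _ ≤ ‖X‖ * ‖V‖ := by
        have h : ∀ Z : ell2, √(∑ n ∈ Finset.range N, ‖Z n‖ ^ 2) ≤ ‖Z‖ := fun Z => by
          refine Real.sqrt_le_iff.2 ⟨norm_nonneg _, ?_⟩
          rw [ell2_norm_sq]
          exact (ell2_summable_sq Z).sum_le_tsum _ fun _ _ => by positivity
        exact mul_le_mul (h X) (h V) (Real.sqrt_nonneg _) (norm_nonneg _)

/-- A Carleman-type estimate: if the imaginary part of the diagonal is definite, then the maximal
Jacobi operator is bounded below. -/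
theorem norm_le_of_jacobiAction {w : ℕ → ℂ} {c s : ℝ} (hs : |s| ≤ 1)
    (hw : ∀ n, c ≤ s * (w n).im) {X V : ell2} (hV : ∀ n, V n = jacobiAction w X n) :
    c * ‖X‖ ≤ ‖V‖ := by
  rcases (norm_nonneg X).eq_or_lt with h0 | hX
  · rw [← h0, mul_zero]; exact norm_nonneg _
  suffices h : c * ‖X‖ ^ 2 ≤ ‖X‖ * ‖V‖ by nlinarith
  by_contra! hlt
  -- Half of the assumed gap pays for truncating `‖X‖²`; the other half has to be carried by the
  -- edge term.
  set ε : ℝ := (c * ‖X‖ ^ 2 - ‖X‖ * ‖V‖) / 2 with hε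
  have hεpos : 0 < ε := by rw [hε]; linarith
  have hlim : Tendsto (fun N => c * ∑ n ∈ Finset.range (N + 1), ‖X n‖ ^ 2) atTop
      (𝓝 (c * ‖X‖ ^ 2)) := by
    rw [ell2_norm_sq]
    exact ((tendsto_add_atTop_iff_nat 1).2
      (ell2_summable_sq X).hasSum.tendsto_sum_nat).const_mul c
  -- The edge term is at least `ε` in modulus and its weight is at most `N + 1`, so the product of
  -- neighbouring entries is at least `ε / (N + 1)`.
  have hev : ∀ᶠ N : ℕ in atTop, ε * ((N : ℝ) + 1)⁻¹ ≤ ‖X N‖ ^ 2 + ‖X (N + 1)‖ ^ 2 := by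
    filter_upwards [hlim.eventually (lt_mem_nhds (show c * ‖X‖ ^ 2 - ε < _ by linarith))]
      with N hN
    have h1 := sum_im_conj_mul_jacobiAction w X N
    have h2 := sum_range_im_le X V (N + 1)
    simp only [hV] at h2
    have h3 : c * ∑ n ∈ Finset.range (N + 1), ‖X n‖ ^ 2 ≤
        s * ∑ n ∈ Finset.range (N + 1), (w n).im * ‖X n‖ ^ 2 := by
      rw [Finset.mul_sum, Finset.mul_sum]
      refine Finset.sum_le_sum fun n _ => ?_
      rw [← mul_assoc]
      exact mul_le_mul_of_nonneg_right (hw n) (by positivity)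
    have hb : |dcoef (N + 1) * (conj (X N) * X (N + 1)).im| ≤
        ((N : ℝ) + 1) * (‖X N‖ * ‖X (N + 1)‖) := by
      rw [abs_mul, abs_of_nonneg (dcoef_nonneg _)]
      refine mul_le_mul (by exact_mod_cast dcoef_le (N + 1)) ?_ (abs_nonneg _) (by positivity)
      refine (Complex.abs_im_le_norm _).trans ?_
      rw [norm_mul, RCLike.norm_conj]
    have hbd : ∀ t B : ℝ, |t| ≤ B → s * t ≤ B := fun t B ht => by
      have h5 : |s * t| ≤ 1 * B := by
        rw [abs_mul]
        exact mul_le_mul hs ht (abs_nonneg _) zero_le_one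
      linarith [le_abs_self (s * t)]
    have h4 := hbd _ _ h2
    have h5 := hbd _ _ ((abs_neg _).trans_le hb)
    rw [h1] at h4
    have h6 : ε ≤ ((N : ℝ) + 1) * (‖X N‖ * ‖X (N + 1)‖) := by
      rw [mul_add] at h4
      rw [mul_neg] at h5
      linarith
    rw [← div_eq_mul_inv, div_le_iff₀ (by positivity)]
    have h7 : ‖X N‖ * ‖X (N + 1)‖ ≤ ‖X N‖ ^ 2 + ‖X (N + 1)‖ ^ 2 := by
      nlinarith [sq_nonneg (‖X N‖ - ‖X (N + 1)‖), sq_nonneg ‖X N‖, sq_nonneg ‖X (N + 1)‖]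
    have hN1 : (0 : ℝ) < (N : ℝ) + 1 := by positivity
    nlinarith
  -- Square-summability of `X` would now force the harmonic series to converge.
  have hsum : Summable fun N : ℕ => ε * ((N : ℝ) + 1)⁻¹ := by
    refine Summable.of_norm_bounded_eventually_nat
      ((ell2_summable_sq X).add ((summable_nat_add_iff 1).2 (ell2_summable_sq X))) ?_
    filter_upwards [hev] with N hN
    rw [Real.norm_of_nonneg (by positivity)]
    exact hN
  have hharm : Summable fun N : ℕ => ((N : ℝ) + 1)⁻¹ := by
    refine (hsum.mul_left ε⁻¹).congr fun N => ?_
    field_simp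
  refine Real.not_summable_natCast_inv ((summable_nat_add_iff 1).1 (hharm.congr fun N => ?_))
  push_cast
  rfl

/-! ### The coefficients `ζₙ` and `yₙ` -/

theorem zeta_ne_zero {Λ : ℂ} (hΛ : Λ.im ≠ 0) (n : ℕ) : zeta Λ n ≠ 0 := fun h => by
  have := zeta_re_pos hΛ n
  rw [h] at this
  simp at this

theorem zeta_conj {Λ : ℂ} (hΛ : Λ.im ≠ 0) (n : ℕ) : zeta (conj Λ) n = conj (zeta Λ n) := by
  have harg : ((n : ℂ) + 1 / 2 - Λ).arg ≠ Real.pi := fun h => by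
    rw [Complex.arg_eq_pi_iff] at h
    have := h.2
    simp at this
    exact hΛ this
  have := Complex.conj_cpow ((n : ℂ) + 1 / 2 - Λ) (2⁻¹ : ℂ) harg
  rw [zeta, zeta]
  simpa [map_ofNat] using this

theorem ycoef_conj {Λ : ℂ} (hΛ : Λ.im ≠ 0) (n : ℕ) : ycoef (conj Λ) n = conj (ycoef Λ n) := by
  rw [ycoef, ycoef, zeta_conj hΛ, map_mul, Complex.conj_ofReal]

/-- Since `n + 1/2 ≥ 1/2`, one has `‖Λ‖ ≤ 2 ‖Λ‖ (n + 1/2)`, which accounts for the factor `1 + 2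
‖Λ‖`. The bound controls both `Im y_n` and `‖η_n‖` from below. -/
theorem zeta_re_le (Λ : ℂ) (n : ℕ) :
    (zeta Λ n).re ≤ √((n : ℝ) + 1 / 2) * √(1 + 2 * ‖Λ‖) := by
  have hn : (0 : ℝ) < (n : ℝ) + 1 / 2 := by positivity
  refine (Complex.re_le_norm _).trans ?_
  rw [← Real.sqrt_mul hn.le]
  apply Real.le_sqrt_of_sq_le
  rw [← norm_pow, zeta_sq]
  have h3 : ‖(n : ℂ) + 1 / 2 - Λ‖ ≤ ((n : ℝ) + 1 / 2) + ‖Λ‖ := by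
    refine (norm_sub_le _ _).trans (add_le_add_left (le_of_eq ?_) _)
    have : (n : ℂ) + 1 / 2 = (((n : ℝ) + 1 / 2 : ℝ) : ℂ) := by push_cast; ring
    rw [this, Complex.norm_real, Real.norm_of_nonneg hn.le]
  have h4 : (0 : ℝ) ≤ n * ‖Λ‖ := by positivity
  linarith

/-- The imaginary part of `ζ_n² = n + 1/2 - Λ` gives `2 Re ζ_n Im ζ_n = -Im Λ`. Hence `|Im y_n| =
√(n + 1/2) |Im Λ| / (2 Re ζ_n)`, and `Re ζ_n` grows no faster than `√(n + 1/2)`. The sign `s` is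
opposite to that of `Im Λ`. -/
theorem exists_le_im_ycoef {Λ : ℂ} (hΛ : Λ.im ≠ 0) :
    ∃ c s : ℝ, 0 < c ∧ |s| ≤ 1 ∧ ∀ n, c ≤ s * (ycoef Λ n).im := by
  set K : ℝ := √(1 + 2 * ‖Λ‖) with hK
  have hKpos : 0 < K := by positivity
  have him : 0 < |Λ.im| := abs_pos.2 hΛ
  refine ⟨|Λ.im| / (2 * K), -(SignType.sign Λ.im : ℝ), by positivity, ?_, fun n => ?_⟩
  · rcases lt_or_gt_of_ne hΛ with h | h
    · simp [sign_neg h]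
    · simp [sign_pos h]
  · have hre := zeta_re_pos hΛ n
    have hn : (0 : ℝ) < (n : ℝ) + 1 / 2 := by positivity
    have h1 : 2 * (zeta Λ n).re * (zeta Λ n).im = -Λ.im := by
      have := congrArg Complex.im (zeta_sq Λ n)
      rw [pow_two, Complex.mul_im] at this
      simp at this
      linarith
    have h2 : (zeta Λ n).re ≤ √((n : ℝ) + 1 / 2) * K := zeta_re_le Λ n
    have h5 : (ycoef Λ n).im = √((n : ℝ) + 1 / 2) * (zeta Λ n).im := by
      rw [ycoef, Complex.im_ofReal_mul]
    have h6 : -(SignType.sign Λ.im : ℝ) * (zeta Λ n).im = |Λ.im| / (2 * (zeta Λ n).re) := by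
      rw [eq_div_iff (by positivity)]
      have : |Λ.im| = (SignType.sign Λ.im : ℝ) * Λ.im := (sign_mul_self Λ.im).symm
      rw [this]
      linear_combination (-(SignType.sign Λ.im : ℝ)) * h1
    rw [h5, mul_left_comm, h6, ← mul_div_assoc, div_le_div_iff₀ (by positivity) (by positivity)]
    nlinarith

theorem exists_le_norm_ycoef {Λ : ℂ} (hΛ : Λ.im ≠ 0) :
    ∃ c : ℝ, 0 < c ∧ ∀ n, c ≤ ‖ycoef Λ n‖ := by
  obtain ⟨c, s, hc, hs, h⟩ := exists_le_im_ycoef hΛ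
  refine ⟨c, hc, fun n => (h n).trans ?_⟩
  calc s * (ycoef Λ n).im ≤ |s| * |(ycoef Λ n).im| := by rw [← abs_mul]; exact le_abs_self _
    _ ≤ 1 * ‖ycoef Λ n‖ :=
        mul_le_mul hs (Complex.abs_im_le_norm _) (abs_nonneg _) zero_le_one
    _ = _ := one_mul _

theorem ycoef_ne_zero {Λ : ℂ} (hΛ : Λ.im ≠ 0) (n : ℕ) : ycoef Λ n ≠ 0 := by
  obtain ⟨c, hc, h⟩ := exists_le_norm_ycoef hΛ
  exact norm_pos_iff.1 (hc.trans_le (h n))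

/-! ### Inverses of the operators in `ℓ²(ℕ₀)` -/

/-- Componentwise action of a uniformly bounded family of operators. -/
def lpMap {E F : ℕ → Type*} [∀ n, NormedAddCommGroup (E n)] [∀ n, NormedSpace ℂ (E n)]
    [∀ n, NormedAddCommGroup (F n)] [∀ n, NormedSpace ℂ (F n)]
    (r : ∀ n, E n →L[ℂ] F n) (C : ℝ) (hr : ∀ n, ‖r n‖ ≤ C) : lp E 2 →L[ℂ] lp F 2 :=
  have hb : ∀ (U : lp E 2) n, ‖r n (U n)‖ ≤ ‖((C : ℂ) • U) n‖ := fun U n => by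
    have hC : 0 ≤ C := (norm_nonneg _).trans (hr n)
    rw [lp.coeFn_smul, Pi.smul_apply, norm_smul, Complex.norm_real, Real.norm_of_nonneg hC]
    exact (r n).le_of_opNorm_le (hr n) _
  LinearMap.mkContinuous
    { toFun := fun U => ⟨fun n => r n (U n), (lp.memℓp ((C : ℂ) • U)).mono' (hb U)⟩
      map_add' := fun U V => lp.ext (funext fun n => map_add (r n) (U n) (V n))
      map_smul' := fun c U => lp.ext (funext fun n => map_smul (r n) c (U n)) } C (fun U => by
    have hC : 0 ≤ C := (norm_nonneg _).trans (hr 0)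
    have h1 : ‖(C : ℂ) • U‖ = C * ‖U‖ := by
      rw [norm_smul, Complex.norm_real, Real.norm_of_nonneg hC]
    rw [← h1]
    exact lp.norm_mono (by norm_num) (hb U))

/-- The bounded diagonal operator `𝒟{ωₙ}`. -/
def diagBdd (w : ℕ → ℂ) (C : ℝ) (hw : ∀ n, ‖w n‖ ≤ C) : ell2 →L[ℂ] ell2 :=
  lpMap (E := fun _ => ℂ) (F := fun _ => ℂ)
    (fun n => w n • ContinuousLinearMap.id ℂ ℂ) C fun n => by
    rw [norm_smul, ContinuousLinearMap.norm_id, mul_one]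
    exact hw n

theorem diagBdd_apply (w : ℕ → ℂ) (C : ℝ) (hw : ∀ n, ‖w n‖ ≤ C) (X : ell2) (n : ℕ) :
    diagBdd w C hw X n = w n * X n := rfl

theorem exists_inverse_two_opY {Λ : ℂ} (hΛ : Λ.im ≠ 0) :
    ∃ Yinv : ell2 →L[ℂ] ell2, IsBoundedInverse ((2 : ℂ) • opY Λ) Yinv ∧
      ∀ F n, Yinv F n = F n / (2 * ycoef Λ n) := by
  obtain ⟨c, hc, h⟩ := exists_le_norm_ycoef hΛ
  have hb : ∀ n, ‖(2 * ycoef Λ n)⁻¹‖ ≤ (2 * c)⁻¹ := fun n => by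
    rw [norm_inv, norm_mul, Complex.norm_ofNat]
    exact inv_anti₀ (by positivity) (mul_le_mul_of_nonneg_left (h n) zero_le_two)
  refine ⟨diagBdd _ _ hb, ⟨fun F => ⟨?_, ?_⟩, fun X => ?_⟩, fun F n => ?_⟩
  · change Memℓp (fun n => ycoef Λ n * ((2 * ycoef Λ n)⁻¹ * F n)) 2
    have h2 : (fun n => ycoef Λ n * ((2 * ycoef Λ n)⁻¹ * F n)) = (2⁻¹ : ℂ) • fun n => F n := by
      funext n
      have := ycoef_ne_zero hΛ n
      rw [Pi.smul_apply, smul_eq_mul]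
      field_simp
    rw [h2]
    exact (lp.memℓp F).const_smul (2⁻¹ : ℂ)
  · refine lp.ext (funext fun n => ?_)
    change (2 : ℂ) * (ycoef Λ n * ((2 * ycoef Λ n)⁻¹ * F n)) = F n
    have := ycoef_ne_zero hΛ n
    field_simp
  · refine lp.ext (funext fun n => ?_)
    change (2 * ycoef Λ n)⁻¹ * ((2 : ℂ) * (ycoef Λ n * (X : ell2) n)) = (X : ell2) n
    have := ycoef_ne_zero hΛ n
    field_simp
  · rw [diagBdd_apply, div_eq_inv_mul]

theorem opJ_apply (Λ : ℂ) (μ : ℝ) (X : (opJ Λ μ).domain) (n : ℕ) :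
    opJ Λ μ X n = jacobiAction (fun n => 2 * (μ : ℂ) * ycoef Λ n) (X : ell2) n := rfl

theorem exists_le_im_two_mul_ycoef {Λ : ℂ} (hΛ : Λ.im ≠ 0) {μ : ℝ} (hμ : 0 < μ) :
    ∃ c s : ℝ, 0 < c ∧ |s| ≤ 1 ∧ ∀ n, c ≤ s * (2 * (μ : ℂ) * ycoef Λ n).im := by
  obtain ⟨c, s, hc, hs, h⟩ := exists_le_im_ycoef hΛ
  refine ⟨2 * μ * c, s, by positivity, hs, fun n => ?_⟩
  have h1 : (2 * (μ : ℂ) * ycoef Λ n).im = 2 * μ * (ycoef Λ n).im := by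
    have : (2 * (μ : ℂ)) = ((2 * μ : ℝ) : ℂ) := by push_cast; ring
    rw [this, Complex.im_ofReal_mul]
  rw [h1, mul_left_comm]
  exact mul_le_mul_of_nonneg_left (h n) (by positivity)

/-- The lower bound holds on the maximal domain, so `X` need not lie in the domain of `opJ`. This
matters in both uses: for vectors orthogonal to the range, and for traces of eigenvectors of `opA`.
-/
theorem jacobi_eq_zero {Λ : ℂ} (hΛ : Λ.im ≠ 0) {μ : ℝ} (hμ : 0 < μ) {X : ell2}
    (h : ∀ n, jacobiAction (fun n => 2 * (μ : ℂ) * ycoef Λ n) X n = 0) : X = 0 := by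
  obtain ⟨c, s, hc, hs, hw⟩ := exists_le_im_two_mul_ycoef hΛ hμ
  have := norm_le_of_jacobiAction hs hw (X := X) (V := 0) fun n => (h n).symm
  rw [norm_zero] at this
  exact norm_le_zero_iff.1 (nonpos_of_mul_nonpos_right this hc)

theorem single_mem_domain_opJ (Λ : ℂ) (μ : ℝ) (n : ℕ) :
    (lp.single 2 n (1 : ℂ) : ell2) ∈ (opJ Λ μ).domain := by
  refine (LinearPMap.le_closure _).1 ?_
  change (Function.support fun m => (lp.single 2 n (1 : ℂ) : ell2) m).Finite
  refine (finite_singleton n).subset fun m hm => ?_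
  by_contra hne
  exact hm (lp.single_apply_ne (E := fun _ : ℕ => ℂ) 2 n 1 hne)

/-- The columns of the matrix, for testing orthogonality to the range. For `n = 0` the index `n - 1`
is again `0`, but its coefficient is `d₀ = 0`. -/
theorem opJ_single (Λ : ℂ) (μ : ℝ) (n : ℕ) :
    opJ Λ μ ⟨lp.single 2 n (1 : ℂ), single_mem_domain_opJ Λ μ n⟩ =
      (dcoef (n + 1) : ℂ) • lp.single 2 (n + 1) (1 : ℂ) +
        (dcoef n : ℂ) • lp.single 2 (n - 1) (1 : ℂ) +
        (2 * (μ : ℂ) * ycoef Λ n) • lp.single 2 n (1 : ℂ) := by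
  refine lp.ext (funext fun m => ?_)
  rw [opJ_apply, jacobiAction]
  simp only [lp.coeFn_add, lp.coeFn_smul, Pi.add_apply, Pi.smul_apply, smul_eq_mul,
    lp.coeFn_single, Pi.single_apply]
  rcases Nat.eq_zero_or_pos m with rfl | hm
  · rcases n with _ | _ | n <;> simp [dcoef_zero]
  · rcases Nat.eq_zero_or_pos n with rfl | hn
    · obtain ⟨m, rfl⟩ : ∃ k, m = k + 1 := ⟨m - 1, by omega⟩
      rcases m with _ | m <;> simp [dcoef_zero]
    · obtain ⟨m, rfl⟩ : ∃ k, m = k + 1 := ⟨m - 1, by omega⟩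
      obtain ⟨n, rfl⟩ : ∃ k, n = k + 1 := ⟨n - 1, by omega⟩
      simp only [Nat.add_sub_cancel, Nat.add_right_cancel_iff]
      by_cases h1 : m = n + 1
      · subst h1; simp [show n + 1 + 1 ≠ n by omega]
      · by_cases h2 : m + 1 = n
        · subst h2; simp [show m ≠ m + 1 + 1 by omega]
        · by_cases h3 : m = n
          · subst h3; simp
          · have h2' : n ≠ m + 1 := fun h => h2 h.symm
            simp [h1, h2, h3]

/-- Because `y_n(Λ) - (n + 1/2)` is bounded, `opJ` is a bounded perturbation of the closed operator
`opJ0`. Being bounded below, it is injective with closed range; the orthogonal complement of the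
range is trivial by the same bound at `Λ̄`. -/
theorem exists_inverse_opJ {Λ : ℂ} (hΛ : Λ.im ≠ 0) {μ : ℝ} (hμ : 0 < μ) :
    ∃ Jinv : ell2 →L[ℂ] ell2, IsBoundedInverse (opJ Λ μ) Jinv := by
  obtain ⟨c, s, hc, hs, hw⟩ := exists_le_im_two_mul_ycoef hΛ hμ
  have hlow : ∀ X : (opJ Λ μ).domain, c * ‖(X : ell2)‖ ≤ ‖opJ Λ μ X‖ := fun X =>
    norm_le_of_jacobiAction hs hw fun n => opJ_apply Λ μ X n
  set D : ell2 →L[ℂ] ell2 :=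
    diagBdd (fun n => ycoef Λ n - ((n : ℂ) + 1 / 2)) ‖Λ‖ (norm_ycoef_sub_le Λ)
  set B : ell2 →L[ℂ] ell2 := (2 * (μ : ℂ)) • D
  have hJ : ∀ X : (opJ Λ μ).domain, opJ Λ μ X = opJ0 μ ⟨(X : ell2), X.2⟩ + B X := fun X => by
    refine lp.ext (funext fun n => ?_)
    change _ = opJ0 μ ⟨(X : ell2), X.2⟩ n +
      2 * (μ : ℂ) * ((ycoef Λ n - ((n : ℂ) + 1 / 2)) * (X : ell2) n)
    rw [opJ_apply, opJ0_apply, jacobiAction, jacobiAction]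
    ring
  have hclosed : IsClosed ((opJ0 μ).graph : Set (ell2 × ell2)) :=
    (jacobiMin_isClosable _).closure_isClosed
  have : CompleteSpace (opJ0 μ).graph := hclosed.completeSpace_coe
  -- On the complete graph of `opJ0` the unbounded operator becomes the bounded map `(X, J₀ X) ↦ J₀
  -- X + B X`, so an antilipschitz bound suffices for closed range.
  let Ψ : (opJ0 μ).graph →L[ℂ] ell2 :=
    (ContinuousLinearMap.snd ℂ ell2 ell2 + B ∘L ContinuousLinearMap.fst ℂ ell2 ell2) ∘L
      (opJ0 μ).graph.subtypeL
  have hΨ : ∀ P : (opJ0 μ).graph, ∃ X : (opJ Λ μ).domain, (X : ell2) = P.1.1 ∧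
      Ψ P = opJ Λ μ X := fun P => by
    obtain ⟨X, h1, h2⟩ := (LinearPMap.mem_graph_iff _).1 P.2
    refine ⟨⟨X, X.2⟩, h1, ?_⟩
    refine Eq.trans ?_ (hJ ⟨X, X.2⟩).symm
    change P.1.2 + B P.1.1 = opJ0 μ X + B X
    rw [← h1, ← h2]
  -- The graph carries the maximum norm: `c⁻¹` controls `X`, and the second constant controls `J₀ X
  -- = J X - B X`.
  have hanti : AntilipschitzWith (Real.toNNReal (max c⁻¹ (1 + ‖B‖ * c⁻¹))) Ψ := by
    refine AddMonoidHomClass.antilipschitz_of_bound Ψ fun P => ?_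
    rw [Real.coe_toNNReal _ (le_max_of_le_left (by positivity))]
    obtain ⟨X, h1, h2⟩ := hΨ P
    have h3 : ‖P.1.1‖ ≤ c⁻¹ * ‖Ψ P‖ := by
      rw [← h1, h2, ← div_eq_inv_mul, le_div_iff₀ hc, mul_comm]
      exact hlow X
    have h4 : ‖P.1.2‖ ≤ (1 + ‖B‖ * c⁻¹) * ‖Ψ P‖ := by
      have h5 : P.1.2 = Ψ P - B P.1.1 := by
        change _ = P.1.2 + B P.1.1 - B P.1.1
        rw [add_sub_cancel_right]
      calc ‖P.1.2‖ ≤ ‖Ψ P‖ + ‖B P.1.1‖ := by rw [h5]; exact norm_sub_le _ _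
        _ ≤ ‖Ψ P‖ + ‖B‖ * (c⁻¹ * ‖Ψ P‖) :=
            add_le_add_right (B.le_opNorm_of_le h3) _
        _ = _ := by ring
    change max ‖P.1.1‖ ‖P.1.2‖ ≤ _
    rw [max_mul_of_nonneg _ _ (norm_nonneg _)]
    exact max_le_max h3 h4
  have hrange : LinearMap.range (opJ Λ μ).toFun = ⊤ := by
    have hcl : IsClosed (LinearMap.range (opJ Λ μ).toFun : Set ell2) := by
      convert hanti.isClosed_range Ψ.uniformContinuous using 1
      ext V
      constructor
      · rintro ⟨X, rfl⟩
        exact ⟨⟨_, (opJ0 μ).mem_graph ⟨X, X.2⟩⟩, (hJ X).symm⟩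
      · rintro ⟨P, rfl⟩
        obtain ⟨X, -, h⟩ := hΨ P
        exact ⟨X, h.symm⟩
    have : CompleteSpace (LinearMap.range (opJ Λ μ).toFun) := hcl.completeSpace_coe
    rw [← Submodule.orthogonal_eq_bot_iff, Submodule.eq_bot_iff]
    intro Z hZ
    -- Pairing `Z` with the `n`-th column conjugates the diagonal, and `conj y_n(Λ) = y_n(Λ̄)`. Thus
    -- `Z` solves the Jacobi equation at `Λ̄`.
    refine jacobi_eq_zero (im_conj_ne_zero hΛ) hμ fun n => ?_
    have h := (Submodule.mem_orthogonal _ _).1 hZ _ ⟨⟨_, single_mem_domain_opJ Λ μ n⟩, rfl⟩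
    change inner ℂ (opJ Λ μ ⟨_, single_mem_domain_opJ Λ μ n⟩) Z = 0 at h
    rw [opJ_single, inner_add_left, inner_add_left, inner_smul_left, inner_smul_left,
      inner_smul_left, lp.inner_single_left, lp.inner_single_left, lp.inner_single_left] at h
    simp only [Complex.conj_ofReal, map_mul, RCLike.inner_apply, map_one, mul_one,
      map_ofNat] at h
    rw [jacobiAction, ycoef_conj hΛ, ← h]
    ring
  have hinj : Function.Injective (opJ Λ μ).toFun := by
    rw [← LinearMap.ker_eq_bot, LinearMap.ker_eq_bot']
    intro X hX
    have h1 := hlow X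
    change opJ Λ μ X = 0 at hX
    rw [hX, norm_zero] at h1
    exact Subtype.ext (norm_le_zero_iff.1 (nonpos_of_mul_nonpos_right h1 hc))
  let e := LinearEquiv.ofBijective (opJ Λ μ).toFun ⟨hinj, LinearMap.range_eq_top.1 hrange⟩
  refine ⟨LinearMap.mkContinuous ((opJ Λ μ).domain.subtype ∘ₗ e.symm.toLinearMap) c⁻¹ ?_,
    fun F => ⟨(e.symm F).2, e.apply_symm_apply F⟩,
    fun X => congrArg Subtype.val (e.symm_apply_apply X)⟩
  intro F
  change ‖((e.symm F : (opJ Λ μ).domain) : ell2)‖ ≤ _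
  rw [← div_eq_inv_mul, le_div_iff₀ hc, mul_comm]
  refine (hlow (e.symm F)).trans_eq ?_
  exact congrArg norm (e.apply_symm_apply F)

/-! ### Weak derivatives on intervals -/

theorem setIntegral_test_smul {Ω : Set ℝ} {φ : ℝ → ℝ} (hs : tsupport φ ⊆ Ω) (u : ℝ → ℂ) :
    ∫ x in Ω, φ x • u x = ∫ x, φ x • u x := by
  refine setIntegral_eq_integral_of_forall_compl_eq_zero fun x hx => ?_
  rw [image_eq_zero_of_notMem_tsupport fun hx' => hx (hs hx'), zero_smul]

theorem HasWeakDeriv.mono {Ω Ω' : Set ℝ} (hΩ : Ω' ⊆ Ω) {u v : ℝ → ℂ} (h : HasWeakDeriv Ω u v) :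
    HasWeakDeriv Ω' u v := by
  intro φ hφ hc hs
  have := h φ hφ hc (hs.trans hΩ)
  have hs' : tsupport (deriv φ) ⊆ Ω' := tsupport_deriv_subset.trans hs
  rwa [setIntegral_test_smul (hs.trans hΩ), setIntegral_test_smul (hs'.trans hΩ),
    ← setIntegral_test_smul hs, ← setIntegral_test_smul hs'] at this

theorem IsH2With.mono {Ω Ω' : Set ℝ} (hΩ : Ω' ⊆ Ω) {u g : ℝ → ℂ} (h : IsH2With Ω u g) :
    IsH2With Ω' u g := by
  obtain ⟨hu, hg, p, hp, h1, h2⟩ := h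
  have hle := Measure.restrict_mono_set volume hΩ
  exact ⟨hu.mono_measure hle, hg.mono_measure hle, p, hp.mono_measure hle, h1.mono hΩ, h2.mono hΩ⟩

theorem hasWeakDeriv_of_hasDerivAt (Ω : Set ℝ) {u v : ℝ → ℂ} (h : ∀ x, HasDerivAt u (v x) x)
    (hv : Continuous v) : HasWeakDeriv Ω u v := by
  refine HasWeakDeriv.mono (subset_univ Ω) fun φ hφ hc _ => ?_
  have hd : Continuous (deriv φ) := hφ.continuous_deriv (by simp)
  have hu : Continuous u := continuous_iff_continuousAt.2 fun x => (h x).continuousAt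
  rw [Measure.restrict_univ]
  have key := integral_bilinear_hasDerivAt_right_eq_neg_left_of_integrable
    (L := ContinuousLinearMap.lsmul ℝ ℝ (E := ℂ)) (u := φ) (u' := deriv φ) (v := u) (v' := v)
    (fun x _ => (hφ.differentiable (by simp) x).hasDerivAt) (fun x _ => h x)
    ((hφ.continuous.smul hv).integrable_of_hasCompactSupport hc.smul_right)
    ((hd.smul hu).integrable_of_hasCompactSupport hc.deriv.smul_right)
    ((hφ.continuous.smul hu).integrable_of_hasCompactSupport hc.smul_right)
  simp only [ContinuousLinearMap.lsmul_apply] at key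
  rw [key, neg_neg]

/-- Complex test functions are needed for the integrating factor `exp (-s x)`; they split into real
and imaginary parts. -/
theorem HasWeakDeriv.integral_deriv_mul {Ω : Set ℝ} {u v : ℝ → ℂ}
    (hu : MemLp u 2 (volume.restrict Ω)) (hv : MemLp v 2 (volume.restrict Ω))
    (h : HasWeakDeriv Ω u v) {ψ : ℝ → ℂ} (hψ : ContDiff ℝ ∞ ψ) (hc : HasCompactSupport ψ)
    (hs : tsupport ψ ⊆ Ω) :
    ∫ x in Ω, deriv ψ x * u x = -∫ x in Ω, ψ x * v x := by
  have hre : ContDiff ℝ ∞ fun x => (ψ x).re := Complex.reCLM.contDiff.comp hψ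
  have him : ContDiff ℝ ∞ fun x => (ψ x).im := Complex.imCLM.contDiff.comp hψ
  have hcre : HasCompactSupport fun x => (ψ x).re := hc.comp_left Complex.zero_re
  have hcim : HasCompactSupport fun x => (ψ x).im := hc.comp_left Complex.zero_im
  have hsre : tsupport (fun x => (ψ x).re) ⊆ Ω :=
    (tsupport_comp_subset (g := Complex.re) Complex.zero_re ψ).trans hs
  have hsim : tsupport (fun x => (ψ x).im) ⊆ Ω :=
    (tsupport_comp_subset (g := Complex.im) Complex.zero_im ψ).trans hs
  have hd : ∀ x, HasDerivAt ψ (deriv ψ x) x := fun x =>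
    (hψ.differentiable (by simp) x).hasDerivAt
  have hdre : ∀ x, deriv (fun x => (ψ x).re) x = (deriv ψ x).re := fun x =>
    (Complex.reCLM.hasFDerivAt.comp_hasDerivAt x (hd x)).deriv
  have hdim : ∀ x, deriv (fun x => (ψ x).im) x = (deriv ψ x).im := fun x =>
    (Complex.imCLM.hasFDerivAt.comp_hasDerivAt x (hd x)).deriv
  have hcdre : Continuous (deriv fun x => (ψ x).re) := hre.continuous_deriv (by simp)
  have hcdim : Continuous (deriv fun x => (ψ x).im) := him.continuous_deriv (by simp)
  have h1 := h _ hre hcre hsre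
  have h2 := h _ him hcim hsim
  have e1 : ∀ x, deriv ψ x * u x = deriv (fun x => (ψ x).re) x • u x +
      Complex.I • (deriv (fun x => (ψ x).im) x • u x) := fun x => by
    rw [hdre, hdim, Complex.real_smul, Complex.real_smul, smul_eq_mul]
    conv_lhs => rw [← Complex.re_add_im (deriv ψ x)]
    ring
  have e2 : ∀ x, ψ x * v x = (ψ x).re • v x + Complex.I • ((ψ x).im • v x) := fun x => by
    rw [Complex.real_smul, Complex.real_smul, smul_eq_mul]
    conv_lhs => rw [← Complex.re_add_im (ψ x)]
    ring
  simp only [e1, e2]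
  rw [integral_add (integrable_test_smul hu hcdre hcre.deriv)
      ((integrable_test_smul hu hcdim hcim.deriv).fun_smul Complex.I),
    integral_add (integrable_test_smul hv hre.continuous hcre)
      ((integrable_test_smul hv him.continuous hcim).fun_smul Complex.I),
    integral_smul, integral_smul, h1, h2, smul_neg, neg_add]

/-- Integrate from the left end of the support. The primitive vanishes past the right end because
the total integral is zero, and the hull of the support stays in `Ω` by order-connectedness. -/
theorem exists_compactSupport_primitive {Ω : Set ℝ} (hΩ : Ω.OrdConnected) {χ : ℝ → ℝ}
    (hχ : ContDiff ℝ ∞ χ) (hc : HasCompactSupport χ) (hs : tsupport χ ⊆ Ω)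
    (h0 : ∫ x, χ x = 0) :
    ∃ φ : ℝ → ℝ, ContDiff ℝ ∞ φ ∧ HasCompactSupport φ ∧ tsupport φ ⊆ Ω ∧ deriv φ = χ := by
  rcases (tsupport χ).eq_empty_or_nonempty with he | hne
  · refine ⟨0, contDiff_const, HasCompactSupport.zero, by simp, ?_⟩
    rw [tsupport_eq_empty_iff] at he
    rw [he]
    funext x
    simp
  have hK : IsCompact (tsupport χ) := hc
  set a := sInf (tsupport χ) with ha
  set b := sSup (tsupport χ) with hb
  have hab : Icc a b ⊆ Ω := hΩ.out (hs (hK.sInf_mem hne)) (hs (hK.sSup_mem hne))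
  have hz : ∀ x, x ∉ Icc a b → χ x = 0 := fun x hx =>
    image_eq_zero_of_notMem_tsupport fun hx' =>
      hx ⟨csInf_le hK.bddBelow hx', le_csSup hK.bddAbove hx'⟩
  have hd : ∀ x, HasDerivAt (fun x => ∫ t in a..x, χ t) (χ x) x := fun x =>
    intervalIntegral.integral_hasDerivAt_right (hχ.continuous.intervalIntegrable _ _)
      hχ.continuous.stronglyMeasurable.stronglyMeasurableAtFilter hχ.continuous.continuousAt
  have hderiv : deriv (fun x => ∫ t in a..x, χ t) = χ := funext fun x => (hd x).deriv
  have hsub : tsupport (fun x => ∫ t in a..x, χ t) ⊆ Icc a b := by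
    refine closure_minimal (fun x hx => ?_) isClosed_Icc
    by_contra hx'
    refine hx ?_
    change ∫ t in a..x, χ t = 0
    rcases lt_or_ge x a with hxa | hxa
    · rw [intervalIntegral.integral_symm, intervalIntegral.integral_of_le hxa.le,
        integral_Ioc_eq_integral_Ioo, setIntegral_eq_zero_of_forall_eq_zero, neg_zero]
      exact fun t ht => hz t fun h => not_le.2 ht.2 h.1
    · have hxb : b < x := by
        by_contra hxb
        exact hx' ⟨hxa, not_lt.1 hxb⟩
      rw [intervalIntegral.integral_of_le hxa, ← integral_Icc_eq_integral_Ioc,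
        setIntegral_eq_integral_of_forall_compl_eq_zero, h0]
      exact fun t ht => hz t fun h => ht ⟨h.1, h.2.trans hxb.le⟩
  refine ⟨_, ?_, isCompact_Icc.of_isClosed_subset (isClosed_tsupport _) hsub, hsub.trans hab,
    hderiv⟩
  rw [contDiff_infty_iff_deriv, hderiv]
  exact ⟨fun x => (hd x).differentiableAt, hχ⟩

/-- The du Bois-Reymond lemma. With a fixed bump `φ₀` of integral one, `ψ - (∫ ψ) φ₀` is the
derivative of a test function for every test function `ψ`; the constant is therefore `∫ φ₀ u`. -/
theorem ae_eq_const_of_integral_deriv_smul_eq_zero {Ω : Set ℝ} (hΩ : IsOpen Ω)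
    (hΩ' : Ω.OrdConnected) {u : ℝ → ℂ} (hu : LocallyIntegrableOn u Ω)
    (h : ∀ φ : ℝ → ℝ, ContDiff ℝ ∞ φ → HasCompactSupport φ → tsupport φ ⊆ Ω →
      ∫ x, deriv φ x • u x = 0) :
    ∃ c : ℂ, u =ᵐ[volume.restrict Ω] fun _ => c := by
  rcases Ω.eq_empty_or_nonempty with rfl | ⟨x₀, hx₀⟩
  · exact ⟨0, by simp [Filter.EventuallyEq]⟩
  obtain ⟨r, hr, hball⟩ := Metric.isOpen_iff.1 hΩ x₀ hx₀
  let f : ContDiffBump x₀ := ⟨r / 4, r / 2, by positivity, by linarith⟩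
  set φ₀ : ℝ → ℝ := f.normed volume with hφ₀
  have hφ₀d : ContDiff ℝ ∞ φ₀ := f.contDiff_normed
  have hφ₀c : HasCompactSupport φ₀ := f.hasCompactSupport_normed
  have hφ₀s : tsupport φ₀ ⊆ Ω := by
    rw [hφ₀, f.tsupport_normed_eq]
    exact (Metric.closedBall_subset_ball (by change r / 2 < r; linarith)).trans hball
  have hφ₀i : ∫ x, φ₀ x = 1 := f.integral_normed
  have hint : ∀ ψ : ℝ → ℝ, ContDiff ℝ ∞ ψ → HasCompactSupport ψ → tsupport ψ ⊆ Ω →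
      Integrable fun x => ψ x • u x := fun ψ hψ hc hs => by
    have h1 : IntegrableOn u (tsupport ψ) := hu.integrableOn_compact_subset hs hc
    have h2 : IntegrableOn (fun x => ψ x • u x) (tsupport ψ) :=
      h1.continuousOn_smul hψ.continuous.continuousOn hc
    refine (integrableOn_iff_integrable_of_support_subset fun x hx => ?_).1 h2
    exact subset_tsupport ψ fun h0 => hx (by simp [h0])
  refine ⟨∫ x, φ₀ x • u x, ?_⟩
  set c := ∫ x, φ₀ x • u x with hc
  have key : ∀ᵐ x ∂volume, x ∈ Ω → u x - c = 0 := by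
    apply hΩ.ae_eq_zero_of_integral_contDiff_smul_eq_zero
    · exact hu.sub ((locallyIntegrable_const c).locallyIntegrableOn Ω)
    · intro ψ hψ hψc hψs
      set I := ∫ x, ψ x with hI
      have hψi : Integrable ψ := hψ.continuous.integrable_of_hasCompactSupport hψc
      have hφ₀i' : Integrable φ₀ := hφ₀d.continuous.integrable_of_hasCompactSupport hφ₀c
      obtain ⟨φ, h1, h2, h3, h4⟩ := exists_compactSupport_primitive hΩ'
        (χ := ψ - I • φ₀) (hψ.sub (contDiff_const.smul hφ₀d))
        (hψc.sub (hφ₀c.smul_left (f := fun _ => I)))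
        ((tsupport_sub ψ (I • φ₀)).trans (union_subset hψs
          ((tsupport_smul_subset_right (fun _ => I) φ₀).trans hφ₀s))) (by
          simp only [Pi.sub_apply, Pi.smul_apply]
          rw [integral_sub hψi (hφ₀i'.fun_smul I), integral_smul, hφ₀i,
            smul_eq_mul, mul_one, sub_self])
      have h5 := h φ h1 h2 h3
      rw [h4] at h5
      simp only [Pi.sub_apply, Pi.smul_apply, sub_smul, smul_assoc] at h5
      rw [integral_sub (hint ψ hψ hψc hψs) ((hint φ₀ hφ₀d hφ₀c hφ₀s).fun_smul I),
        integral_smul] at h5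
      simp only [smul_sub]
      rw [integral_sub (hint ψ hψ hψc hψs) (hψi.smul_const c), integral_smul_const]
      exact h5
  filter_upwards [(ae_restrict_iff' hΩ.measurableSet).2 key] with x hx
  exact sub_eq_zero.1 hx

/-- Integrating factor: `exp (-s x) u` has zero weak derivative, as testing `u' = s u` against `φ
exp (-s x)` shows. -/
theorem HasWeakDeriv.exists_ae_eq_exp {Ω : Set ℝ} (hΩ : IsOpen Ω) (hΩ' : Ω.OrdConnected)
    {u v : ℝ → ℂ} (hu : MemLp u 2 (volume.restrict Ω)) (hv : MemLp v 2 (volume.restrict Ω))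
    (h : HasWeakDeriv Ω u v) {s : ℂ} (hs : v =ᵐ[volume.restrict Ω] fun x => s * u x) :
    ∃ c : ℂ, u =ᵐ[volume.restrict Ω] fun x => c * Complex.exp (s * x) := by
  set e : ℝ → ℂ := fun x => Complex.exp (-s * x) with he
  have hed : ContDiff ℝ ∞ e := by
    have : ContDiff ℝ ∞ fun x : ℝ => (x : ℂ) := Complex.ofRealCLM.contDiff
    exact (contDiff_const.mul this).cexp
  have hed' : ∀ x, HasDerivAt e (-s * e x) x := fun x => by
    have h1 : HasDerivAt (fun x : ℝ => -s * (x : ℂ)) (-s) x := by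
      simpa using (Complex.ofRealCLM.hasDerivAt (x := x)).const_mul (-s)
    have h2 := h1.cexp
    rwa [mul_comm] at h2
  obtain ⟨c, hc⟩ := ae_eq_const_of_integral_deriv_smul_eq_zero hΩ hΩ' (u := fun x => e x * u x) (by
      have h1 : LocallyIntegrableOn u Ω :=
        locallyIntegrableOn_of_locallyIntegrable_restrict (hu.locallyIntegrable (by norm_num))
      exact h1.continuousOn_smul hΩ.isLocallyClosed hed.continuous.continuousOn) (by
      intro φ hφ hc hsφ
      have hφC : ContDiff ℝ ∞ fun x => (φ x : ℂ) := Complex.ofRealCLM.contDiff.comp hφ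
      set ψ : ℝ → ℂ := fun x => (φ x : ℂ) * e x with hψ
      have hψs : tsupport ψ ⊆ tsupport φ := by
        refine closure_mono fun x hx h0 => hx ?_
        simp [hψ, h0]
      have hψc : HasCompactSupport ψ := hc.of_isClosed_subset (isClosed_tsupport _) hψs
      have hψd : ContDiff ℝ ∞ ψ := hφC.mul hed
      have hd : ∀ x, deriv ψ x = ((deriv φ x : ℝ) : ℂ) * e x - s * ψ x := fun x => by
        have h1 : HasDerivAt (fun x => (φ x : ℂ)) ((deriv φ x : ℝ) : ℂ) x :=
          ((hφ.differentiable (by simp) x).hasDerivAt).ofReal_comp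
        refine (h1.mul (hed' x)).deriv.trans ?_
        simp only [hψ]
        ring
      have h1 := h.integral_deriv_mul hu hv hψd hψc (hψs.trans hsφ)
      have hψL : MemLp ψ 2 (volume.restrict Ω) :=
        hψd.continuous.memLp_of_hasCompactSupport hψc
      have hψi : Integrable (fun x => ψ x * u x) (volume.restrict Ω) :=
        memLp_one_iff_integrable.1 (hu.mul hψL)
      have hψL' : MemLp (deriv ψ) 2 (volume.restrict Ω) :=
        (hψd.continuous_deriv (by simp)).memLp_of_hasCompactSupport hψc.deriv
      have hψi' : Integrable (fun x => deriv ψ x * u x) (volume.restrict Ω) :=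
        memLp_one_iff_integrable.1 (hu.mul hψL')
      have h2 : ∫ x in Ω, ψ x * v x = s * ∫ x in Ω, ψ x * u x := by
        rw [← integral_const_mul]
        refine integral_congr_ae ?_
        filter_upwards [hs] with x hx
        rw [hx]
        ring
      rw [← setIntegral_test_smul (tsupport_deriv_subset.trans hsφ)]
      have h3 : ∀ x, deriv φ x • (e x * u x) = deriv ψ x * u x + s * (ψ x * u x) := fun x => by
        rw [hd, Complex.real_smul]
        ring
      simp only [h3]
      rw [integral_add hψi' (hψi.const_mul s), integral_const_mul, h1, h2, neg_add_cancel])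
  refine ⟨c, ?_⟩
  filter_upwards [hc] with x hx
  rw [← hx, he]
  simp only
  rw [mul_right_comm, ← Complex.exp_add]
  simp

/-- On `S` the exponential has modulus at least one, so the constant `c` would be square-integrable
on a set of infinite measure. -/
theorem eq_zero_of_memLp_exp {S : Set ℝ} (hS : MeasurableSet S) (hv : volume S = ⊤) {s c : ℂ}
    (hs : ∀ x ∈ S, 0 ≤ s.re * x)
    (h : MemLp (fun x : ℝ => c * Complex.exp (s * x)) 2 (volume.restrict S)) : c = 0 := by
  have h1 : MemLp (fun _ : ℝ => c) 2 (volume.restrict S) := by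
    refine h.of_le aestronglyMeasurable_const ?_
    filter_upwards [ae_restrict_mem hS] with x hx
    rw [norm_mul, Complex.norm_exp, Complex.re_mul_ofReal]
    exact le_mul_of_one_le_right (norm_nonneg _) (Real.one_le_exp (hs x hx))
  rcases (memLp_const_iff (by norm_num) (by norm_num)).1 h1 with h2 | h2
  · exact h2
  · rw [Measure.restrict_apply_univ, hv] at h2
    exact absurd h2 (lt_irrefl _)

/-- Solutions of `u'' = s² u` in `H²(Ω)` that cannot grow on `S ⊆ Ω`. -/
theorem IsH2With.exists_ae_eq_exp {Ω S : Set ℝ} (hΩ : IsOpen Ω) (hΩ' : Ω.OrdConnected)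
    (hSΩ : S ⊆ Ω) (hS : MeasurableSet S) (hv : volume S = ⊤) {s : ℂ}
    (hs : ∀ x ∈ S, 0 ≤ s.re * x) {u g : ℝ → ℂ} (h : IsH2With Ω u g)
    (hg : g =ᵐ[volume.restrict Ω] fun x => s ^ 2 * u x) :
    ∃ c : ℂ, u =ᵐ[volume.restrict Ω] fun x => c * Complex.exp (-s * x) := by
  obtain ⟨hu, hgL, p, hp, h1, h2⟩ := h
  -- Factor the equation: `v = u' + s u` satisfies `v' = s v`, so `v = c exp (s x)`.
  -- Square-integrability on `S` forces `c = 0`, leaving `u' = -s u`.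
  obtain ⟨c, hc⟩ := (h2.add hp hgL (hu.const_smul s) (hp.const_smul s)
    (h1.smul s)).exists_ae_eq_exp hΩ hΩ' (s := s) (hp.add (hu.const_smul s))
    (hgL.add (hp.const_smul s)) (by
      filter_upwards [hg] with x hx
      simp only [Pi.add_apply, Pi.smul_apply, smul_eq_mul, hx]
      ring)
  have hc0 : c = 0 := by
    refine eq_zero_of_memLp_exp hS hv hs ?_
    refine MemLp.mono_measure (Measure.restrict_mono_set volume hSΩ) ?_
    exact (memLp_congr_ae hc).1 (hp.add (hu.const_smul s))
  refine h1.exists_ae_eq_exp hΩ hΩ' hu hp ?_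
  filter_upwards [hc] with x hx
  rw [hc0] at hx
  simp only [Pi.add_apply, Pi.smul_apply, smul_eq_mul] at hx
  linear_combination hx

theorem HasWeakDeriv.congr_deriv {Ω : Set ℝ} {u v v' : ℝ → ℂ} (h : HasWeakDeriv Ω u v)
    (hv : v = v') : HasWeakDeriv Ω u v' := hv ▸ h

/-! ### Convolution with exponentially decaying kernels -/

theorem integrable_exp_neg_mul_abs {c : ℝ} (hc : 0 < c) :
    Integrable fun t : ℝ => Real.exp (-c * |t|) := by
  rw [← integrableOn_univ, ← Iic_union_Ioi (a := (0 : ℝ))]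
  apply IntegrableOn.union
  · refine (integrableOn_exp_mul_Iic hc 0).congr_fun (fun x hx => ?_) measurableSet_Iic
    simp only [abs_of_nonpos (mem_Iic.1 hx)]
    ring_nf
  · refine (integrableOn_exp_mul_Ioi (neg_lt_zero.2 hc) 0).congr_fun (fun x hx => ?_)
      measurableSet_Ioi
    simp only [abs_of_pos (mem_Ioi.1 hx)]

theorem integral_exp_neg_mul_abs {c : ℝ} (hc : 0 < c) :
    ∫ t : ℝ, Real.exp (-c * |t|) = 2 / c := by
  rw [integral_comp_abs (f := fun x => Real.exp (-c * x)),
    integral_exp_mul_Ioi (neg_lt_zero.2 hc)]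
  field_simp
  simp

theorem memLp_exp_neg_mul_abs {c : ℝ} (hc : 0 < c) :
    MemLp (fun t : ℝ => Real.exp (-c * |t|)) 2 := by
  refine (memLp_two_iff_integrable_sq (by fun_prop)).2 ?_
  refine (integrable_exp_neg_mul_abs (c := 2 * c) (by positivity)).congr (ae_of_all _ fun t => ?_)
  simp only [← Real.exp_nat_mul]
  congr 1
  push_cast
  ring

/-- A kernel that decays like `exp (-c |t|)` and is continuous off the origin. -/
structure IsExpKernel (c : ℝ) (k : ℝ → ℂ) : Prop where
  pos : 0 < c
  measurable : Measurable k
  norm_le : ∀ t, ‖k t‖ ≤ Real.exp (-c * |t|)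
  continuousAt : ∀ t, t ≠ 0 → ContinuousAt k t

/-- The convolution `k ⋆ f`. -/
def kconv (k f : ℝ → ℂ) (x : ℝ) : ℂ := ∫ y, k (x - y) * f y

theorem kconv_congr_ae (k : ℝ → ℂ) {f g : ℝ → ℂ} (h : f =ᵐ[volume] g) :
    kconv k f = kconv k g := by
  funext x
  refine integral_congr_ae ?_
  filter_upwards [h] with y hy
  rw [hy]

theorem integrable_exp_mul_norm {c : ℝ} (hc : 0 < c) {f : ℝ → ℂ} (hf : MemLp f 2) (x : ℝ) :
    Integrable fun y => Real.exp (-c * |x - y|) * ‖f y‖ := by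
  have h1 : MemLp (fun y : ℝ => Real.exp (-c * |x - y|)) 2 :=
    (memLp_exp_neg_mul_abs hc).comp_measurePreserving
      (Measure.measurePreserving_sub_left volume x)
  exact h1.integrable_mul hf.norm

theorem integrable_exp_mul_norm_sq {c : ℝ} (hc : 0 < c) {f : ℝ → ℂ} (hf : MemLp f 2) (x : ℝ) :
    Integrable fun y => Real.exp (-c * |x - y|) * ‖f y‖ ^ 2 := by
  refine hf.norm.integrable_sq.bdd_mul (c := 1) (by fun_prop) (ae_of_all _ fun y => ?_)
  rw [Real.norm_of_nonneg (Real.exp_pos _).le, Real.exp_le_one_iff]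
  have := abs_nonneg (x - y)
  nlinarith

theorem IsExpKernel.integrable {c : ℝ} {k : ℝ → ℂ} (hk : IsExpKernel c k) {f : ℝ → ℂ}
    (hf : MemLp f 2) (x : ℝ) : Integrable fun y => k (x - y) * f y := by
  refine (integrable_exp_mul_norm hk.pos hf x).mono'
    ((hk.measurable.comp (measurable_const.sub measurable_id)).aestronglyMeasurable.mul
      hf.aestronglyMeasurable) (ae_of_all _ fun y => ?_)
  rw [norm_mul]
  exact mul_le_mul_of_nonneg_right (hk.norm_le _) (norm_nonneg _)

/-- Dominated convergence. A jump of `k` at the origin affects only `y = x₀`, a null set; moving `x`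
by less than one costs a factor `exp c` in the majorant. -/
theorem IsExpKernel.continuous_kconv {c : ℝ} {k : ℝ → ℂ} (hk : IsExpKernel c k) {f : ℝ → ℂ}
    (hf : MemLp f 2) : Continuous (kconv k f) := by
  refine continuous_iff_continuousAt.2 fun x₀ => ?_
  refine continuousAt_of_dominated
    (bound := fun y => Real.exp c * (Real.exp (-c * |x₀ - y|) * ‖f y‖))
    (Eventually.of_forall fun x => (hk.integrable hf x).aestronglyMeasurable) ?_
    ((integrable_exp_mul_norm hk.pos hf x₀).const_mul _) ?_
  · filter_upwards [Metric.ball_mem_nhds x₀ one_pos] with x hx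
    refine ae_of_all _ fun y => ?_
    rw [norm_mul, ← mul_assoc, ← Real.exp_add]
    refine mul_le_mul_of_nonneg_right ((hk.norm_le _).trans (Real.exp_le_exp.2 ?_)) (norm_nonneg _)
    have h1 : |x₀ - y| ≤ |x₀ - x| + |x - y| := abs_sub_le _ _ _
    have h2 : |x₀ - x| < 1 := by rwa [abs_sub_comm, ← Real.dist_eq]
    have := hk.pos
    nlinarith
  · filter_upwards [Measure.ae_ne volume x₀] with y hy
    have h1 : ContinuousAt k (x₀ - y) := hk.continuousAt _ (sub_ne_zero.2 hy.symm)
    have h2 : ContinuousAt (fun x => k (x - y)) x₀ :=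
      ContinuousAt.comp (f := fun x : ℝ => x - y) h1 (by fun_prop)
    exact h2.mul continuousAt_const

theorem sq_integral_exp_mul_norm_le {c : ℝ} (hc : 0 < c) {f : ℝ → ℂ} (hf : MemLp f 2) (x : ℝ) :
    (∫ y, Real.exp (-c * |x - y|) * ‖f y‖) ^ 2 ≤
      2 / c * ∫ y, Real.exp (-c * |x - y|) * ‖f y‖ ^ 2 := by
  set a := ∫ y, Real.exp (-c * |x - y|) * ‖f y‖ with ha
  set b := ∫ y, Real.exp (-c * |x - y|) * ‖f y‖ ^ 2 with hb
  have hE : Integrable fun y : ℝ => Real.exp (-c * |x - y|) :=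
    (integrable_exp_neg_mul_abs hc).comp_sub_left x
  have hEi : ∫ y : ℝ, Real.exp (-c * |x - y|) = 2 / c := by
    rw [integral_sub_left_eq_self (fun t => Real.exp (-c * |t|)) volume x,
      integral_exp_neg_mul_abs hc]
  have h1 := integrable_exp_mul_norm hc hf x
  have h2 := integrable_exp_mul_norm_sq hc hf x
  -- Cauchy–Schwarz for the weight `exp (-c |x - y|)`: the quadratic is the weighted integral of `(t
  -- - ‖f y‖)²`. It is evaluated below at its minimum `t = a c / 2`.
  have key : ∀ t : ℝ, 0 ≤ t ^ 2 * (2 / c) - 2 * t * a + b := fun t => by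
    rw [← hEi, ha, hb, ← integral_const_mul, ← integral_const_mul,
      ← integral_sub (hE.const_mul _) (h1.const_mul _)]
    have h3 : Integrable fun y => t ^ 2 * Real.exp (-c * |x - y|) -
        2 * t * (Real.exp (-c * |x - y|) * ‖f y‖) := (hE.const_mul _).sub (h1.const_mul _)
    rw [← integral_add h3 h2]
    refine integral_nonneg fun y => ?_
    have : t ^ 2 * Real.exp (-c * |x - y|) - 2 * t * (Real.exp (-c * |x - y|) * ‖f y‖) +
        Real.exp (-c * |x - y|) * ‖f y‖ ^ 2 = Real.exp (-c * |x - y|) * (t - ‖f y‖) ^ 2 := by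
      ring
    change 0 ≤ t ^ 2 * Real.exp (-c * |x - y|) - 2 * t * (Real.exp (-c * |x - y|) * ‖f y‖) +
        Real.exp (-c * |x - y|) * ‖f y‖ ^ 2
    rw [this]
    positivity
  have h3 := key (a * c / 2)
  have h4 : (a * c / 2) ^ 2 * (2 / c) - 2 * (a * c / 2) * a + b = b - a ^ 2 * c / 2 := by
    field_simp
    ring
  rw [h4] at h3
  rw [div_mul_eq_mul_div, le_div_iff₀ hc]
  linarith

theorem IsExpKernel.norm_sq_kconv_le {c : ℝ} {k : ℝ → ℂ} (hk : IsExpKernel c k) {f : ℝ → ℂ}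
    (hf : MemLp f 2) (x : ℝ) :
    ‖kconv k f x‖ ^ 2 ≤ 2 / c * ∫ y, Real.exp (-c * |x - y|) * ‖f y‖ ^ 2 := by
  refine le_trans ?_ (sq_integral_exp_mul_norm_le hk.pos hf x)
  refine pow_le_pow_left₀ (norm_nonneg _) ?_ 2
  refine norm_integral_le_of_norm_le (integrable_exp_mul_norm hk.pos hf x) (ae_of_all _ fun y => ?_)
  rw [norm_mul]
  exact mul_le_mul_of_nonneg_right (hk.norm_le _) (norm_nonneg _)

theorem integrable_prod_exp_mul {c : ℝ} (hc : 0 < c) {F : ℝ → ℝ} (hF : Integrable F) :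
    Integrable (fun p : ℝ × ℝ => Real.exp (-c * |p.1 - p.2|) * F p.2) (volume.prod volume) := by
  have := hF.convolution_integrand (ContinuousLinearMap.mul ℝ ℝ) (integrable_exp_neg_mul_abs hc)
  refine this.congr (ae_of_all _ fun p => ?_)
  simp [mul_comm]

theorem integral_integral_exp_mul {c : ℝ} (hc : 0 < c) {F : ℝ → ℝ} (hF : Integrable F) :
    ∫ x, ∫ y, Real.exp (-c * |x - y|) * F y = 2 / c * ∫ y, F y := by
  rw [integral_integral_swap (integrable_prod_exp_mul hc hF), ← integral_const_mul]
  refine integral_congr_ae (ae_of_all _ fun y => ?_)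
  simp only
  rw [integral_mul_const, integral_sub_right_eq_self (fun t => Real.exp (-c * |t|)),
    integral_exp_neg_mul_abs hc]

theorem IsExpKernel.memLp_kconv {c : ℝ} {k : ℝ → ℂ} (hk : IsExpKernel c k) {f : ℝ → ℂ}
    (hf : MemLp f 2) : MemLp (kconv k f) 2 := by
  have hm := (hk.continuous_kconv hf).aestronglyMeasurable (μ := volume)
  refine (memLp_two_iff_integrable_sq_norm hm).2 ?_
  refine (((integrable_prod_exp_mul hk.pos hf.norm.integrable_sq).integral_prod_left).const_mul
    (2 / c)).mono' (hm.norm.pow 2) (ae_of_all _ fun x => ?_)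
  rw [Real.norm_of_nonneg (by positivity)]
  exact hk.norm_sq_kconv_le hf x

/-- Schur's test: the mass `2 / c` of the exponential enters once through Cauchy–Schwarz and once
through Fubini. -/
theorem IsExpKernel.integral_norm_sq_kconv_le {c : ℝ} {k : ℝ → ℂ} (hk : IsExpKernel c k)
    {f : ℝ → ℂ} (hf : MemLp f 2) :
    ∫ x, ‖kconv k f x‖ ^ 2 ≤ (2 / c) ^ 2 * ∫ x, ‖f x‖ ^ 2 := by
  have hi := integrable_prod_exp_mul hk.pos hf.norm.integrable_sq
  calc ∫ x, ‖kconv k f x‖ ^ 2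
      ≤ ∫ x, 2 / c * ∫ y, Real.exp (-c * |x - y|) * ‖f y‖ ^ 2 :=
        integral_mono (hk.memLp_kconv hf).norm.integrable_sq
          (hi.integral_prod_left.const_mul (2 / c)) fun x => hk.norm_sq_kconv_le hf x
    _ = _ := by
        rw [integral_const_mul, integral_integral_exp_mul hk.pos hf.norm.integrable_sq]
        ring

/-- The bound `|φ| ‖f‖ ≤ ‖f‖² + φ²` separates the variables, so that only integrable functions are
convolved with the exponential. -/
theorem IsExpKernel.integrable_prod {c : ℝ} {k : ℝ → ℂ} (hk : IsExpKernel c k) {f : ℝ → ℂ}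
    (hf : MemLp f 2) {φ : ℝ → ℝ} (hφ : Continuous φ) (hφc : HasCompactSupport φ) :
    Integrable (fun p : ℝ × ℝ => φ p.1 • (k (p.1 - p.2) * f p.2)) (volume.prod volume) := by
  have h1 := integrable_prod_exp_mul hk.pos hf.norm.integrable_sq
  have hφ2 : Integrable fun x => φ x ^ 2 :=
    (hφ.memLp_of_hasCompactSupport hφc).integrable_sq
  have h2 : Integrable (fun p : ℝ × ℝ => Real.exp (-c * |p.2 - p.1|) * φ p.1 ^ 2)
      (volume.prod volume) := (integrable_prod_exp_mul hk.pos hφ2).swap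
  have hm : AEStronglyMeasurable (fun p : ℝ × ℝ => φ p.1 • (k (p.1 - p.2) * f p.2))
      (volume.prod volume) := by
    refine (hφ.comp continuous_fst).aestronglyMeasurable.smul (AEStronglyMeasurable.mul ?_ ?_)
    · exact (hk.measurable.comp measurable_sub).aestronglyMeasurable
    · exact hf.aestronglyMeasurable.comp_snd
  refine (h1.add h2).mono' hm (ae_of_all _ fun p => ?_)
  rw [Pi.add_apply, norm_smul, norm_mul, abs_sub_comm p.2 p.1, ← mul_add, mul_left_comm,
    Real.norm_eq_abs]
  have h3 : |φ p.1| * ‖f p.2‖ ≤ ‖f p.2‖ ^ 2 + φ p.1 ^ 2 := by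
    rw [← sq_abs (φ p.1)]
    nlinarith [sq_nonneg (|φ p.1| - ‖f p.2‖), sq_nonneg |φ p.1|, sq_nonneg ‖f p.2‖]
  exact mul_le_mul (hk.norm_le _) h3 (by positivity) (Real.exp_pos _).le

theorem IsExpKernel.integral_smul_kconv {c : ℝ} {k : ℝ → ℂ} (hk : IsExpKernel c k) {f : ℝ → ℂ}
    (hf : MemLp f 2) {φ : ℝ → ℝ} (hφ : Continuous φ) (hφc : HasCompactSupport φ) :
    ∫ x, φ x • kconv k f x = ∫ y, (∫ x, φ x • k (x - y)) * f y := by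
  have h := integral_integral_swap (f := fun x y => φ x • (k (x - y) * f y))
    (hk.integrable_prod hf hφ hφc)
  simp only [kconv, ← integral_smul, ← integral_mul_const]
  rw [h]
  simp only [smul_mul_assoc]

theorem IsExpKernel.integrable_integral_mul {c : ℝ} {k : ℝ → ℂ} (hk : IsExpKernel c k)
    {f : ℝ → ℂ} (hf : MemLp f 2) {φ : ℝ → ℝ} (hφ : Continuous φ) (hφc : HasCompactSupport φ) :
    Integrable fun y => (∫ x, φ x • k (x - y)) * f y := by
  refine (hk.integrable_prod hf hφ hφc).integral_prod_right.congr (ae_of_all _ fun y => ?_)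
  simp only [← integral_mul_const, smul_mul_assoc]

/-- If `k' = -σ k - ε δ₀` in the sense of distributions, then `(k ⋆ f)' = -σ (k ⋆ f) - ε f`. -/
theorem IsExpKernel.hasWeakDeriv_kconv {c : ℝ} {k : ℝ → ℂ} (hk : IsExpKernel c k) {ε σ : ℂ}
    (h : ∀ φ : ℝ → ℝ, ContDiff ℝ ∞ φ → HasCompactSupport φ → ∀ y,
      ∫ x, deriv φ x • k (x - y) = ε * φ y + σ * ∫ x, φ x • k (x - y))
    {f : ℝ → ℂ} (hf : MemLp f 2) :
    HasWeakDeriv univ (kconv k f) fun x => -σ * kconv k f x - ε * f x := by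
  intro φ hφ hc _
  have hd : Continuous (deriv φ) := hφ.continuous_deriv (by simp)
  have hfi : Integrable fun x => φ x • f x := by
    have := integrable_test_smul (Ω := univ) (u := f) (by rwa [Measure.restrict_univ])
      hφ.continuous hc
    rwa [Measure.restrict_univ] at this
  have hki : Integrable fun x => φ x • kconv k f x := by
    have := integrable_test_smul (Ω := univ) (u := kconv k f)
      (by rw [Measure.restrict_univ]; exact hk.memLp_kconv hf) hφ.continuous hc
    rwa [Measure.restrict_univ] at this
  rw [Measure.restrict_univ, hk.integral_smul_kconv hf hd hc.deriv]
  have e1 : ∀ y, (∫ x, deriv φ x • k (x - y)) * f y =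
      ε * (φ y • f y) + σ * ((∫ x, φ x • k (x - y)) * f y) := fun y => by
    rw [h φ hφ hc, Complex.real_smul]
    ring
  have e2 : ∀ x, φ x • (-σ * kconv k f x - ε * f x) =
      -(σ * (φ x • kconv k f x) + ε * (φ x • f x)) := fun x => by
    simp only [Complex.real_smul]
    ring
  simp only [e1, e2]
  rw [integral_neg, neg_neg, integral_add (hfi.const_mul ε)
    ((hk.integrable_integral_mul hf hφ.continuous hc).const_mul σ),
    integral_add (hki.const_mul σ) (hfi.const_mul ε)]
  simp only [integral_const_mul]
  rw [hk.integral_smul_kconv hf hφ.continuous hc, add_comm]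

/-! ### Convolution as a bounded operator in `L²(ℝ)`. -/

theorem L2R_norm_sq (f : L2R) : ‖f‖ ^ 2 = ∫ x, ‖f x‖ ^ 2 := by
  rw [← @inner_self_eq_norm_sq ℂ, L2.inner_def, ← integral_re (L2.integrable_inner _ _)]
  simp only [inner_self_eq_norm_sq]

theorem norm_toLp_sq {f : ℝ → ℂ} (hf : MemLp f 2) : ‖(hf.toLp : L2R)‖ ^ 2 = ∫ x, ‖f x‖ ^ 2 := by
  rw [L2R_norm_sq]
  refine integral_congr_ae ?_
  filter_upwards [hf.coeFn_toLp] with x hx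
  rw [hx]

/-- Convolution with `k` as a bounded operator in `L²(ℝ)`. -/
def IsExpKernel.convL {c : ℝ} {k : ℝ → ℂ} (hk : IsExpKernel c k) : L2R →L[ℂ] L2R :=
  LinearMap.mkContinuous
    { toFun := fun f => (hk.memLp_kconv (Lp.memLp f)).toLp
      map_add' := fun f g => by
        rw [← MemLp.toLp_add]
        refine MemLp.toLp_congr _ _ (ae_of_all _ fun x => ?_)
        rw [kconv_congr_ae k (Lp.coeFn_add f g), Pi.add_apply, kconv, kconv, kconv,
          ← integral_add (hk.integrable (Lp.memLp f) x) (hk.integrable (Lp.memLp g) x)]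
        simp only [Pi.add_apply, mul_add]
      map_smul' := fun a f => by
        rw [RingHom.id_apply, ← MemLp.toLp_const_smul]
        refine MemLp.toLp_congr _ _ (ae_of_all _ fun x => ?_)
        rw [kconv_congr_ae k (Lp.coeFn_smul a f), Pi.smul_apply, kconv, kconv, smul_eq_mul,
          ← integral_const_mul]
        simp only [Pi.smul_apply, smul_eq_mul, mul_left_comm] } (2 / c) fun f => by
    have hc := hk.pos
    refine le_of_sq_le_sq ?_ (by positivity)
    rw [mul_pow, L2R_norm_sq f]
    refine (norm_toLp_sq (hk.memLp_kconv (Lp.memLp f))).trans_le ?_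
    exact hk.integral_norm_sq_kconv_le (Lp.memLp f)

theorem IsExpKernel.convL_apply {c : ℝ} {k : ℝ → ℂ} (hk : IsExpKernel c k) (f : L2R) :
    (hk.convL f : ℝ → ℂ) =ᵐ[volume] kconv k f :=
  (hk.memLp_kconv (Lp.memLp f)).coeFn_toLp

theorem IsExpKernel.norm_convL_le {c : ℝ} {k : ℝ → ℂ} (hk : IsExpKernel c k) :
    ‖hk.convL‖ ≤ 2 / c :=
  LinearMap.mkContinuous_norm_le _ (div_nonneg zero_le_two hk.pos.le) _

/-! ### The resolvent of `-d²/dx²` on the line -/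

/-- The kernel of the causal solution operator of `u' + s u = f`. -/
def kerR (s : ℂ) : ℝ → ℂ := (Ioi 0).indicator fun t => Complex.exp (-s * t)

/-- The kernel of the anti-causal solution operator of `-u' + s u = f`. -/
def kerL (s : ℂ) : ℝ → ℂ := (Iio 0).indicator fun t => Complex.exp (s * t)

/-- The kernel `exp (-s |t|)`. -/
def kerE (s : ℂ) (t : ℝ) : ℂ := Complex.exp (-s * (|t| : ℝ))

theorem isExpKernel_kerR {s : ℂ} (hs : 0 < s.re) : IsExpKernel s.re (kerR s) where
  pos := hs
  measurable := (by fun_prop : Measurable fun t : ℝ => Complex.exp (-s * t)).indicator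
    measurableSet_Ioi
  norm_le t := by
    by_cases ht : t ∈ Ioi 0
    · rw [kerR, indicator_of_mem ht, Complex.norm_exp, Complex.re_mul_ofReal, abs_of_pos ht,
        Complex.neg_re]
    · rw [kerR, indicator_of_notMem ht, norm_zero]
      exact (Real.exp_pos _).le
  continuousAt t ht := by
    rcases lt_or_gt_of_ne ht with h | h
    · refine (continuousAt_const (y := (0 : ℂ))).congr ?_
      filter_upwards [Iio_mem_nhds h] with x hx
      rw [kerR, indicator_of_notMem (notMem_Ioi.2 (le_of_lt hx))]
    · refine (by fun_prop : Continuous fun t : ℝ => Complex.exp (-s * t)).continuousAt.congr ?_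
      filter_upwards [Ioi_mem_nhds h] with x hx
      rw [kerR, indicator_of_mem hx]

theorem isExpKernel_kerL {s : ℂ} (hs : 0 < s.re) : IsExpKernel s.re (kerL s) where
  pos := hs
  measurable := (by fun_prop : Measurable fun t : ℝ => Complex.exp (s * t)).indicator
    measurableSet_Iio
  norm_le t := by
    by_cases ht : t ∈ Iio 0
    · rw [kerL, indicator_of_mem ht, Complex.norm_exp, Complex.re_mul_ofReal, abs_of_neg ht,
        neg_mul_neg]
    · rw [kerL, indicator_of_notMem ht, norm_zero]
      exact (Real.exp_pos _).le
  continuousAt t ht := by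
    rcases lt_or_gt_of_ne ht with h | h
    · refine (by fun_prop : Continuous fun t : ℝ => Complex.exp (s * t)).continuousAt.congr ?_
      filter_upwards [Iio_mem_nhds h] with x hx
      rw [kerL, indicator_of_mem hx]
    · refine (continuousAt_const (y := (0 : ℂ))).congr ?_
      filter_upwards [Ioi_mem_nhds h] with x hx
      rw [kerL, indicator_of_notMem (notMem_Iio.2 (le_of_lt hx))]

theorem isExpKernel_kerE {s : ℂ} (hs : 0 < s.re) : IsExpKernel s.re (kerE s) where
  pos := hs
  measurable := by unfold kerE; fun_prop
  norm_le t := by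
    rw [kerE, Complex.norm_exp, Complex.re_mul_ofReal, Complex.neg_re]
  continuousAt t _ := by unfold kerE; fun_prop

/-- The split reduces the second-order problem to two first-order ones. At the origin both one-sided
kernels vanish, which is invisible to the convolution. -/
theorem kerE_eq_add (s : ℂ) {t : ℝ} (ht : t ≠ 0) : kerE s t = kerR s t + kerL s t := by
  rcases lt_or_gt_of_ne ht with h | h
  · rw [kerR, kerL, indicator_of_notMem (notMem_Ioi.2 h.le), indicator_of_mem (mem_Iio.2 h), kerE,
      abs_of_neg h, zero_add]
    push_cast
    rw [neg_mul_neg]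
  · rw [kerR, kerL, indicator_of_mem (mem_Ioi.2 h), indicator_of_notMem (notMem_Iio.2 h.le), kerE,
      abs_of_pos h, add_zero]

theorem kconv_kerE {s : ℂ} (hs : 0 < s.re) {f : ℝ → ℂ} (hf : MemLp f 2) (x : ℝ) :
    kconv (kerE s) f x = kconv (kerR s) f x + kconv (kerL s) f x := by
  rw [kconv, kconv, kconv, ← integral_add ((isExpKernel_kerR hs).integrable hf x)
    ((isExpKernel_kerL hs).integrable hf x)]
  refine integral_congr_ae ?_
  filter_upwards [Measure.ae_ne volume x] with y hy
  rw [kerE_eq_add s (sub_ne_zero.2 hy.symm), add_mul]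

theorem hasDerivAt_smul_exp {φ : ℝ → ℝ} (hφ : ContDiff ℝ ∞ φ) (a : ℂ) (y x : ℝ) :
    HasDerivAt (fun x => φ x • Complex.exp (a * ((x - y : ℝ) : ℂ)))
      (deriv φ x • Complex.exp (a * ((x - y : ℝ) : ℂ)) +
        a * (φ x • Complex.exp (a * ((x - y : ℝ) : ℂ)))) x := by
  have h1 : HasDerivAt φ (deriv φ x) x := (hφ.differentiable (by simp) x).hasDerivAt
  have h2 : HasDerivAt (fun x : ℝ => a * ((x - y : ℝ) : ℂ)) a x := by
    simpa using (((hasDerivAt_id x).sub_const y).ofReal_comp).const_mul a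
  have h3 := h1.smul h2.cexp
  refine h3.congr_deriv ?_
  simp only [Complex.real_smul]
  ring

theorem contDiff_smul_exp {φ : ℝ → ℝ} (hφ : ContDiff ℝ ∞ φ) (a : ℂ) (y : ℝ) :
    ContDiff ℝ 1 fun x => φ x • Complex.exp (a * ((x - y : ℝ) : ℂ)) := by
  have h1 : ContDiff ℝ 1 fun x : ℝ => ((x - y : ℝ) : ℂ) :=
    Complex.ofRealCLM.contDiff.comp (contDiff_id.sub contDiff_const)
  exact (hφ.of_le (by exact_mod_cast le_top)).smul (contDiff_const.mul h1).cexp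

theorem integrable_smul_exp {φ : ℝ → ℝ} (hφ : Continuous φ) (hc : HasCompactSupport φ) (a : ℂ)
    (y : ℝ) : Integrable fun x => φ x • Complex.exp (a * ((x - y : ℝ) : ℂ)) := by
  have h : Continuous fun x : ℝ => Complex.exp (a * ((x - y : ℝ) : ℂ)) := by fun_prop
  exact (hφ.smul h).integrable_of_hasCompactSupport hc.smul_right

theorem integral_smul_kerR (s : ℂ) (φ : ℝ → ℝ) (y : ℝ) :
    ∫ x, φ x • kerR s (x - y) = ∫ x in Ioi y, φ x • Complex.exp (-s * ((x - y : ℝ) : ℂ)) := by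
  rw [← integral_indicator measurableSet_Ioi]
  refine integral_congr_ae (ae_of_all _ fun x => ?_)
  by_cases hx : y < x
  · simp [kerR, indicator, hx]
  · simp [kerR, indicator, hx]

theorem integral_smul_kerL (s : ℂ) (φ : ℝ → ℝ) (y : ℝ) :
    ∫ x, φ x • kerL s (x - y) = ∫ x in Iic y, φ x • Complex.exp (s * ((x - y : ℝ) : ℂ)) := by
  rw [integral_Iic_eq_integral_Iio, ← integral_indicator measurableSet_Iio]
  refine integral_congr_ae (ae_of_all _ fun x => ?_)
  by_cases hx : x < y
  · simp [kerL, indicator, hx]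
  · simp [kerL, indicator, hx]

/-- The distributional identity `k' = -s k + δ₀`, from the fundamental theorem of calculus on `(y,
∞)`. The factor `-1` is kept visible to fit the `ε` of `hasWeakDeriv_kconv`. -/
theorem integral_deriv_smul_kerR (s : ℂ) {φ : ℝ → ℝ} (hφ : ContDiff ℝ ∞ φ)
    (hc : HasCompactSupport φ) (y : ℝ) :
    ∫ x, deriv φ x • kerR s (x - y) = -1 * φ y + s * ∫ x, φ x • kerR s (x - y) := by
  have hd : Continuous (deriv φ) := hφ.continuous_deriv (by simp)
  have h := HasCompactSupport.integral_Ioi_deriv_eq (contDiff_smul_exp hφ (-s) y) hc.smul_right y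
  rw [integral_smul_kerR, integral_smul_kerR]
  simp only [fun x => (hasDerivAt_smul_exp hφ (-s) y x).deriv] at h
  rw [integral_add (integrable_smul_exp hd hc.deriv _ _).integrableOn
    ((integrable_smul_exp hφ.continuous hc _ _).const_mul _).integrableOn,
    integral_const_mul] at h
  simp only [sub_self, Complex.ofReal_zero, mul_zero, Complex.exp_zero, Complex.real_smul,
    mul_one] at h ⊢
  linear_combination h

theorem integral_deriv_smul_kerL (s : ℂ) {φ : ℝ → ℝ} (hφ : ContDiff ℝ ∞ φ)
    (hc : HasCompactSupport φ) (y : ℝ) :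
    ∫ x, deriv φ x • kerL s (x - y) = 1 * φ y + -s * ∫ x, φ x • kerL s (x - y) := by
  have hd : Continuous (deriv φ) := hφ.continuous_deriv (by simp)
  have h := HasCompactSupport.integral_Iic_deriv_eq (contDiff_smul_exp hφ s y) hc.smul_right y
  rw [integral_smul_kerL, integral_smul_kerL]
  simp only [fun x => (hasDerivAt_smul_exp hφ s y x).deriv] at h
  rw [integral_add (integrable_smul_exp hd hc.deriv _ _).integrableOn
    ((integrable_smul_exp hφ.continuous hc _ _).const_mul _).integrableOn,
    integral_const_mul] at h
  simp only [sub_self, Complex.ofReal_zero, mul_zero, Complex.exp_zero, Complex.real_smul,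
    mul_one] at h ⊢
  linear_combination h

/-- The `L²` solution of `-u'' + s² u = f` on the line. -/
def freeSol (s : ℂ) (f : ℝ → ℂ) (x : ℝ) : ℂ := (2 * s)⁻¹ * kconv (kerE s) f x

/-- The derivative of `freeSol`. -/
def freeSolDeriv (s : ℂ) (f : ℝ → ℂ) (x : ℝ) : ℂ :=
  2⁻¹ * (kconv (kerL s) f x - kconv (kerR s) f x)

theorem freeSol_eq {s : ℂ} (hs : 0 < s.re) {f : ℝ → ℂ} (hf : MemLp f 2) :
    freeSol s f = (2 * s)⁻¹ • (kconv (kerR s) f + kconv (kerL s) f) :=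
  funext fun x => by
    rw [freeSol, kconv_kerE hs hf, Pi.smul_apply, Pi.add_apply, smul_eq_mul]

theorem freeSolDeriv_eq (s : ℂ) (f : ℝ → ℂ) :
    freeSolDeriv s f = (2⁻¹ : ℂ) • (kconv (kerL s) f + (-1 : ℂ) • kconv (kerR s) f) :=
  funext fun x => by
    simp only [freeSolDeriv, Pi.smul_apply, Pi.add_apply, smul_eq_mul]
    ring

theorem memLp_freeSol {s : ℂ} (hs : 0 < s.re) {f : ℝ → ℂ} (hf : MemLp f 2) :
    MemLp (freeSol s f) 2 :=
  ((isExpKernel_kerE hs).memLp_kconv hf).const_mul _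

theorem memLp_freeSolDeriv {s : ℂ} (hs : 0 < s.re) {f : ℝ → ℂ} (hf : MemLp f 2) :
    MemLp (freeSolDeriv s f) 2 :=
  (((isExpKernel_kerL hs).memLp_kconv hf).sub ((isExpKernel_kerR hs).memLp_kconv hf)).const_mul _

theorem continuous_freeSol {s : ℂ} (hs : 0 < s.re) {f : ℝ → ℂ} (hf : MemLp f 2) :
    Continuous (freeSol s f) :=
  continuous_const.mul ((isExpKernel_kerE hs).continuous_kconv hf)

theorem continuous_freeSolDeriv {s : ℂ} (hs : 0 < s.re) {f : ℝ → ℂ} (hf : MemLp f 2) :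
    Continuous (freeSolDeriv s f) :=
  continuous_const.mul (((isExpKernel_kerL hs).continuous_kconv hf).sub
    ((isExpKernel_kerR hs).continuous_kconv hf))

/-- The one-sided convolutions satisfy `R' = -s R + f` and `L' = s L - f`. In the sum the source
cancels; in the difference it doubles. -/
theorem hasWeakDeriv_freeSol {s : ℂ} (hs : 0 < s.re) {f : ℝ → ℂ} (hf : MemLp f 2) :
    HasWeakDeriv univ (freeSol s f) (freeSolDeriv s f) ∧
    HasWeakDeriv univ (freeSolDeriv s f) (fun x => s ^ 2 * freeSol s f x - f x) := by
  have hs0 : s ≠ 0 := fun h => by simp [h] at hs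
  have kR := isExpKernel_kerR hs
  have kL := isExpKernel_kerL hs
  have hR := kR.hasWeakDeriv_kconv (fun φ hφ hc y => integral_deriv_smul_kerR s hφ hc y) hf
  have hL := kL.hasWeakDeriv_kconv (fun φ hφ hc y => integral_deriv_smul_kerL s hφ hc y) hf
  have mR : MemLp (kconv (kerR s) f) 2 (volume.restrict univ) := by
    rw [Measure.restrict_univ]; exact kR.memLp_kconv hf
  have mL : MemLp (kconv (kerL s) f) 2 (volume.restrict univ) := by
    rw [Measure.restrict_univ]; exact kL.memLp_kconv hf
  have mf : MemLp f 2 (volume.restrict univ) := by rwa [Measure.restrict_univ]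
  have mR' := (mR.const_mul (-s)).sub (mf.const_mul (-1))
  have mL' := (mL.const_mul (- -s)).sub (mf.const_mul 1)
  constructor
  · have h := (hR.add mR mR' mL mL' hL).smul (2 * s)⁻¹
    rw [← freeSol_eq hs hf] at h
    refine h.congr_deriv ?_
    funext x
    simp only [freeSolDeriv, Pi.smul_apply, Pi.add_apply, Pi.sub_apply, smul_eq_mul]
    field_simp
    ring
  · have h := (hL.add mL mL' (mR.const_smul (-1 : ℂ)) (mR'.const_smul (-1 : ℂ))
      (hR.smul (-1 : ℂ))).smul (2⁻¹ : ℂ)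
    rw [← freeSolDeriv_eq] at h
    refine h.congr_deriv ?_
    funext x
    simp only [freeSol_eq hs hf, Pi.smul_apply, Pi.add_apply, Pi.sub_apply, smul_eq_mul]
    field_simp
    ring

theorem isH2With_freeSol {s : ℂ} (hs : 0 < s.re) {f : ℝ → ℂ} (hf : MemLp f 2) :
    IsH2With univ (freeSol s f) fun x => s ^ 2 * freeSol s f x - f x := by
  have h := hasWeakDeriv_freeSol hs hf
  rw [IsH2With, Measure.restrict_univ]
  exact ⟨memLp_freeSol hs hf, ((memLp_freeSol hs hf).const_mul _).sub hf, _,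
    memLp_freeSolDeriv hs hf, h.1, h.2⟩

/-- The weak derivative is continuous, so the solution differs from its primitive by a constant,
almost everywhere and hence everywhere. Classical differentiability at `0` shows that the free part
has no derivative jump. -/
theorem hasDerivAt_freeSol {s : ℂ} (hs : 0 < s.re) {f : ℝ → ℂ} (hf : MemLp f 2)
    (x : ℝ) : HasDerivAt (freeSol s f) (freeSolDeriv s f x) x := by
  have hpc := continuous_freeSolDeriv hs hf
  have hwc := continuous_freeSol hs hf
  set W : ℝ → ℂ := fun x => ∫ t in (0 : ℝ)..x, freeSolDeriv s f t with hW
  have hWd : ∀ x, HasDerivAt W (freeSolDeriv s f x) x := fun x =>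
    intervalIntegral.integral_hasDerivAt_right (hpc.intervalIntegrable _ _)
      hpc.stronglyMeasurable.stronglyMeasurableAtFilter hpc.continuousAt
  have hWc : Continuous W := continuous_iff_continuousAt.2 fun x => (hWd x).continuousAt
  obtain ⟨c, hc⟩ := ae_eq_const_of_integral_deriv_smul_eq_zero isOpen_univ ordConnected_univ
    (u := fun x => freeSol s f x - W x) ((hwc.sub hWc).locallyIntegrable.locallyIntegrableOn _) (by
      intro φ hφ hφc hφs
      have hd : Continuous (deriv φ) := hφ.continuous_deriv (by simp)
      have h1 := (hasWeakDeriv_freeSol hs hf).1 φ hφ hφc hφs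
      have h2 := hasWeakDeriv_of_hasDerivAt univ hWd hpc φ hφ hφc hφs
      rw [Measure.restrict_univ] at h1 h2
      simp only [smul_sub]
      rw [integral_sub ((hd.fun_smul hwc).integrable_of_hasCompactSupport hφc.deriv.smul_right)
        ((hd.fun_smul hWc).integrable_of_hasCompactSupport hφc.deriv.smul_right), h1, h2, sub_self])
  rw [Measure.restrict_univ,
    Continuous.ae_eq_iff_eq volume (hwc.fun_sub hWc) continuous_const] at hc
  have h3 : freeSol s f = fun x => W x + c := funext fun x => by
    rw [← congrFun hc x]
    ring
  rw [h3]
  exact (hWd x).add_const c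

/-- The resolvent `(-d²/dx² + s²)⁻¹` in `L²(ℝ)`. -/
def freeRes {s : ℂ} (hs : 0 < s.re) : L2R →L[ℂ] L2R :=
  (2 * s)⁻¹ • (isExpKernel_kerE hs).convL

theorem freeRes_apply {s : ℂ} (hs : 0 < s.re) (f : L2R) :
    (freeRes hs f : ℝ → ℂ) =ᵐ[volume] freeSol s f := by
  filter_upwards [Lp.coeFn_smul (2 * s)⁻¹ ((isExpKernel_kerE hs).convL f),
    (isExpKernel_kerE hs).convL_apply f] with x h1 h2
  refine h1.trans ?_
  rw [Pi.smul_apply, h2, smul_eq_mul, freeSol]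

theorem norm_freeRes_le {s : ℂ} (hs : 0 < s.re) : ‖freeRes hs‖ ≤ (s.re ^ 2)⁻¹ := by
  rw [freeRes, norm_smul, norm_inv, norm_mul, Complex.norm_ofNat]
  have h1 : (2 * ‖s‖)⁻¹ ≤ (2 * s.re)⁻¹ :=
    inv_anti₀ (by positivity) (mul_le_mul_of_nonneg_left (Complex.re_le_norm s) zero_le_two)
  refine (mul_le_mul h1 (isExpKernel_kerE hs).norm_convL_le (norm_nonneg _)
    (by positivity)).trans_eq ?_
  field_simp

theorem freeSol_zero (s : ℂ) (f : ℝ → ℂ) :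
    freeSol s f 0 = (2 * s)⁻¹ * ∫ y, Complex.exp (-s * (|y| : ℝ)) * f y := by
  simp [freeSol, kconv, kerE]

/-! ### The resolvent of `A₀` -/

/-- A bounded right inverse and a trivial kernel suffice: `R (A - z) u - u` is annihilated by `A -
z`. -/
theorem isBoundedInverse_shiftOp {E : Type*} [NormedAddCommGroup E] [NormedSpace ℂ E]
    {A : E →ₗ.[ℂ] E} {z : ℂ} {R : E →L[ℂ] E} (h1 : ∀ f, (R f, f + z • R f) ∈ A.graph)
    (h2 : ∀ U, (U, z • U) ∈ A.graph → U = 0) : IsBoundedInverse (shiftOp A z) R := by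
  refine ⟨fun f => ?_, fun u => ?_⟩
  · obtain ⟨X, hX1, hX2⟩ := (LinearPMap.mem_graph_iff _).1 (h1 f)
    obtain ⟨X, hX⟩ := X
    change X = R f at hX1
    subst hX1
    refine ⟨hX, ?_⟩
    change A ⟨R f, hX⟩ - z • R f = f
    rw [hX2]
    exact add_sub_cancel_right _ _
  · let a : A.domain := u
    change R (A a - z • (a : E)) = (a : E)
    have h3 := A.graph.sub_mem (h1 (A a - z • (a : E))) (A.mem_graph a)
    refine sub_eq_zero.1 (h2 _ ?_)
    convert h3 using 1
    refine Prod.ext rfl ?_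
    change z • (R (A a - z • (a : E)) - (a : E)) =
      A a - z • (a : E) + z • R (A a - z • (a : E)) - A a
    rw [smul_sub]
    abel

theorem ae_eq_zeta_sq_mul {Λ : ℂ} {n : ℕ} {u g v : ℝ → ℂ}
    (hv : v =ᵐ[volume] fun x => Λ * u x)
    (h : v =ᵐ[volume] fun x => -g x + ((n : ℂ) + 1 / 2) * u x) :
    g =ᵐ[volume] fun x => zeta Λ n ^ 2 * u x := by
  filter_upwards [hv, h] with x h1 h2
  rw [zeta_sq]
  linear_combination h2 - h1

/-- Square-integrability at `+∞` leaves only `c exp (-ζ_n x)` in each component, and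
square-integrability at `-∞` then gives `c = 0`. -/
theorem opA0_eq_zero {Λ : ℂ} (hΛ : Λ.im ≠ 0) {U : GH} (h : (U, Λ • U) ∈ opA0.graph) : U = 0 := by
  rw [opA0_graph] at h
  obtain ⟨g, hg⟩ := h
  refine lp.ext (funext fun n => ?_)
  obtain ⟨h1, h2⟩ := hg n
  change IsH2With univ (U n : ℝ → ℂ) (g n) at h1
  have hz := zeta_re_pos hΛ n
  have hgn := ae_eq_zeta_sq_mul (u := (U n : ℝ → ℂ)) (Lp.coeFn_smul Λ (U n)) h2
  obtain ⟨c, hc⟩ := h1.exists_ae_eq_exp isOpen_univ ordConnected_univ (subset_univ _)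
    measurableSet_Ioi Real.volume_Ioi (s := zeta Λ n)
    (fun x hx => mul_nonneg hz.le (le_of_lt hx)) (ae_restrict_of_ae hgn)
  rw [Measure.restrict_univ] at hc
  have hc0 : c = 0 := by
    refine eq_zero_of_memLp_exp (S := Iio 0) measurableSet_Iio Real.volume_Iio (s := -zeta Λ n)
      (fun x hx => ?_) ?_
    · rw [Complex.neg_re]
      exact mul_nonneg_of_nonpos_of_nonpos (neg_nonpos.2 hz.le) (le_of_lt hx)
    · exact ((memLp_congr_ae hc).1 (Lp.memLp (U n))).restrict _
  apply Lp.ext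
  filter_upwards [hc, Lp.coeFn_zero ℂ 2 (volume : Measure ℝ)] with x h3 h4
  rw [h3, hc0, zero_mul]
  exact h4.symm

theorem exists_inverse_opA0 {Λ : ℂ} (hΛ : Λ.im ≠ 0) :
    ∃ R₀ : GH →L[ℂ] GH, IsBoundedInverse (shiftOp opA0 Λ) R₀ ∧
      ∀ f n, (R₀ f n : ℝ → ℂ) =ᵐ[volume] freeSol (zeta Λ n) (f n) := by
  obtain ⟨C, hC, hCn⟩ := exists_zeta_bound hΛ
  -- From `1/2 ≤ n + 1/2 ≤ C² (Re ζ_n)²`; uniformity in `n` makes the componentwise resolvent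
  -- bounded.
  have hb : ∀ n, ‖freeRes (zeta_re_pos hΛ n)‖ ≤ 2 * C ^ 2 := fun n => by
    have hz := zeta_re_pos hΛ n
    refine (norm_freeRes_le hz).trans ?_
    rw [inv_le_iff_one_le_mul₀ (by positivity)]
    have h1 := hCn n
    have h2 : (0 : ℝ) ≤ n := n.cast_nonneg
    linarith
  have happ : ∀ f n, (lpMap (E := fun _ => L2R) (F := fun _ => L2R)
      (fun n => freeRes (zeta_re_pos hΛ n)) _ hb f n : ℝ → ℂ) =ᵐ[volume]
        freeSol (zeta Λ n) (f n) := fun f n =>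
    freeRes_apply (zeta_re_pos hΛ n) (f n)
  refine ⟨lpMap _ _ hb, isBoundedInverse_shiftOp (fun f => ?_) fun U => opA0_eq_zero hΛ, happ⟩
  rw [opA0_graph]
  refine ⟨fun n x => zeta Λ n ^ 2 * freeSol (zeta Λ n) (f n) x - f n x, fun n => ⟨?_, ?_⟩⟩
  · exact (isH2With_freeSol (zeta_re_pos hΛ n) (Lp.memLp (f n))).congr_ae
      (ae_restrict_of_ae (happ f n).symm)
  · set W : GH := lpMap (E := fun _ => L2R) (F := fun _ => L2R)
      (fun n => freeRes (zeta_re_pos hΛ n)) _ hb f with hW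
    filter_upwards [happ f n, Lp.coeFn_add (f n) (Λ • W n), Lp.coeFn_smul Λ (W n)] with x h1 h2 h3
    change (f n + Λ • W n : L2R) x = _ + _ * (W n : ℝ → ℂ) x
    rw [h2, Pi.add_apply, h3, Pi.smul_apply, smul_eq_mul, h1, zeta_sq]
    ring

/-! ### The functions `ηₙ` -/

/-- `(n + 1/2)^{1/4}`. -/
def qcoef (n : ℕ) : ℝ := ((n : ℝ) + 1 / 2) ^ (1 / 4 : ℝ)

theorem qcoef_pos (n : ℕ) : 0 < qcoef n := Real.rpow_pos_of_pos (by positivity) _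

theorem qcoef_sq (n : ℕ) : qcoef n ^ 2 = √((n : ℝ) + 1 / 2) := by
  rw [qcoef, ← Real.rpow_natCast, ← Real.rpow_mul (by positivity), Real.sqrt_eq_rpow]
  norm_num

/-- This explains the normalization of `η_n`: with traces in units of `q_n` and each matching
condition multiplied by `q_n`, the coupling becomes a symmetric Jacobi matrix. -/
theorem dcoef_succ_eq (n : ℕ) : dcoef (n + 1) = √((n : ℝ) + 1) * qcoef n * qcoef (n + 1) := by
  rw [dcoef_succ, qcoef, qcoef]
  push_cast
  ring_nf

theorem dcoef_eq (n : ℕ) : dcoef n = √(n : ℝ) * qcoef n * qcoef (n - 1) := by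
  rcases n with _ | n
  · simp [dcoef_zero]
  · rw [dcoef_succ_eq, Nat.add_sub_cancel]
    push_cast
    ring

theorem ycoef_eq (Λ : ℂ) (n : ℕ) : ycoef Λ n = (qcoef n : ℂ) ^ 2 * zeta Λ n := by
  rw [ycoef, ← qcoef_sq]
  push_cast
  ring

theorem eta_eq (Λ : ℂ) (n : ℕ) (x : ℝ) :
    eta Λ n x = (qcoef n : ℂ) * Complex.exp (-zeta Λ n * (|x| : ℝ)) := rfl

theorem eta_zero (Λ : ℂ) (n : ℕ) : eta Λ n 0 = (qcoef n : ℂ) := by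
  simp [eta_eq]

theorem eta_of_nonneg (Λ : ℂ) (n : ℕ) {x : ℝ} (hx : 0 ≤ x) :
    eta Λ n x = (qcoef n : ℂ) * Complex.exp (-zeta Λ n * x) := by
  rw [eta_eq, abs_of_nonneg hx]

theorem eta_of_nonpos (Λ : ℂ) (n : ℕ) {x : ℝ} (hx : x ≤ 0) :
    eta Λ n x = (qcoef n : ℂ) * Complex.exp (zeta Λ n * x) := by
  rw [eta_eq, abs_of_nonpos hx]
  push_cast
  rw [neg_mul_neg]

theorem hasDerivAt_mul_exp (a s : ℂ) (x : ℝ) :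
    HasDerivAt (fun x : ℝ => a * Complex.exp (s * x)) (s * (a * Complex.exp (s * x))) x := by
  have h1 : HasDerivAt (fun x : ℝ => s * (x : ℂ)) s x := by
    simpa using (Complex.ofRealCLM.hasDerivAt (x := x)).const_mul s
  refine (h1.cexp.const_mul a).congr_deriv ?_
  ring

theorem hasDerivWithinAt_eta_Ioi (Λ : ℂ) (n : ℕ) :
    HasDerivWithinAt (eta Λ n) (-zeta Λ n * qcoef n) (Ioi 0) 0 := by
  have h := (hasDerivAt_mul_exp (qcoef n) (-zeta Λ n) 0).hasDerivWithinAt (s := Ioi 0)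
  simp only [Complex.ofReal_zero, mul_zero, Complex.exp_zero, mul_one] at h
  exact h.congr (fun x hx => eta_of_nonneg Λ n (le_of_lt hx)) (eta_of_nonneg Λ n le_rfl)

theorem hasDerivWithinAt_eta_Iio (Λ : ℂ) (n : ℕ) :
    HasDerivWithinAt (eta Λ n) (zeta Λ n * qcoef n) (Iio 0) 0 := by
  have h := (hasDerivAt_mul_exp (qcoef n) (zeta Λ n) 0).hasDerivWithinAt (s := Iio 0)
  simp only [Complex.ofReal_zero, mul_zero, Complex.exp_zero, mul_one] at h
  exact h.congr (fun x hx => eta_of_nonpos Λ n (le_of_lt hx)) (eta_of_nonpos Λ n le_rfl)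

theorem isH2With_of_eq_exp {Ω : Set ℝ} (hΩ : MeasurableSet Ω) {u : ℝ → ℂ}
    (hu : MemLp u 2 (volume.restrict Ω)) {a s : ℂ}
    (h : ∀ x ∈ Ω, u x = a * Complex.exp (s * x)) :
    IsH2With Ω u fun x => s ^ 2 * u x := by
  have hae : (fun x : ℝ => a * Complex.exp (s * x)) =ᵐ[volume.restrict Ω] u := by
    filter_upwards [ae_restrict_mem hΩ] with x hx
    rw [h x hx]
  have h1 : HasWeakDeriv Ω u (s • u) := by
    have h2 := (hasWeakDeriv_of_hasDerivAt Ω (hasDerivAt_mul_exp a s) (by fun_prop)).congr_ae hae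
    intro φ hφ hc hs
    rw [h2 φ hφ hc hs]
    congr 1
    refine integral_congr_ae ?_
    filter_upwards [hae] with x hx
    rw [hx, Pi.smul_apply, smul_eq_mul]
  refine ⟨hu, hu.const_mul _, s • u, hu.const_smul s, h1, (h1.smul s).congr_deriv ?_⟩
  funext x
  simp only [Pi.smul_apply, smul_eq_mul]
  ring

theorem isWWith_eta {Λ : ℂ} (hΛ : Λ.im ≠ 0) (n : ℕ) :
    IsWWith (eta Λ n) fun x => zeta Λ n ^ 2 * eta Λ n x := by
  refine ⟨continuous_eta Λ n, ?_, ?_⟩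
  · exact isH2With_of_eq_exp measurableSet_Iio ((memLp_eta hΛ n).restrict _)
      fun x hx => eta_of_nonpos Λ n (le_of_lt hx)
  · rw [← neg_sq]
    exact isH2With_of_eq_exp measurableSet_Ioi ((memLp_eta hΛ n).restrict _)
      fun x hx => eta_of_nonneg Λ n (le_of_lt hx)

/-- Makes `T(Λ)` bounded below, so that the coefficients of an element `{X_n η_n}` of `GH` are
square-summable. -/
theorem le_norm_etaLp {Λ : ℂ} (hΛ : Λ.im ≠ 0) (n : ℕ) : (√(1 + 2 * ‖Λ‖))⁻¹ ≤ ‖etaLp hΛ n‖ ^ 2 := by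
  have hz := zeta_re_pos hΛ n
  rw [etaLp, norm_toLp_sq, integral_norm_eta_sq hΛ, inv_le_iff_one_le_mul₀ (by positivity),
    div_mul_eq_mul_div, one_le_div hz]
  exact zeta_re_le Λ n

theorem conj_eta_conj {Λ : ℂ} (hΛ : Λ.im ≠ 0) (n : ℕ) (x : ℝ) :
    conj (eta (conj Λ) n x) = eta Λ n x := by
  rw [eta_eq, eta_eq, map_mul, Complex.conj_ofReal, ← Complex.exp_conj, map_mul, map_neg,
    zeta_conj hΛ, Complex.conj_conj, Complex.conj_ofReal]

theorem opT_single {Λ : ℂ} (hΛ : Λ.im ≠ 0) (n : ℕ) :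
    opT hΛ (lp.single 2 n (1 : ℂ)) = lp.single 2 n (etaLp hΛ n) := by
  refine lp.ext (funext fun m => ?_)
  change (lp.single 2 n (1 : ℂ) : ell2) m • etaLp hΛ m = _
  by_cases h : m = n
  · subst h
    rw [lp.single_apply_self, lp.single_apply_self, one_smul]
  · rw [lp.single_apply_ne _ _ _ h, lp.single_apply_ne _ _ _ h, zero_smul]

/-- The adjoint integrates `f_n` against `conj η_n(·; Λ̄) = η_n(·; Λ)`, which up to a factor is the
free resolvent kernel at `x = 0`. So `T(Λ̄)*` reads off the trace of the free solution. -/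
theorem adjoint_opT_apply {Λ : ℂ} (hΛ : Λ.im ≠ 0) (f : GH) (n : ℕ) :
    ContinuousLinearMap.adjoint (opT (im_conj_ne_zero hΛ)) f n =
      2 * zeta Λ n * qcoef n * freeSol (zeta Λ n) (f n) 0 := by
  have h1 := lp.inner_single_left (𝕜 := ℂ) n (1 : ℂ)
    (ContinuousLinearMap.adjoint (opT (im_conj_ne_zero hΛ)) f)
  rw [ContinuousLinearMap.adjoint_inner_right, opT_single, lp.inner_single_left] at h1
  simp only [RCLike.inner_apply, map_one, mul_one] at h1
  rw [← h1, L2.inner_def, freeSol_zero]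
  have hz := zeta_ne_zero hΛ n
  have h2 : ∫ x, inner ℂ ((etaLp (im_conj_ne_zero hΛ) n : ℝ → ℂ) x) ((f n : ℝ → ℂ) x) =
      qcoef n * ∫ y, Complex.exp (-zeta Λ n * (|y| : ℝ)) * f n y := by
    rw [← integral_const_mul]
    refine integral_congr_ae ?_
    filter_upwards [(memLp_eta (im_conj_ne_zero hΛ) n).coeFn_toLp] with x hx
    rw [etaLp, hx, RCLike.inner_apply, conj_eta_conj hΛ, eta_eq]
    ring
  rw [h2]
  field_simp

/-! ### The resolvent of `A_α` -/

theorem qcoef_mul_matching (Z : ℕ → ℂ) (n : ℕ) :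
    (qcoef n : ℂ) * ((√((n : ℝ) + 1) : ℂ) * (Z (n + 1) * qcoef (n + 1)) +
      (√(n : ℝ) : ℂ) * (Z (n - 1) * qcoef (n - 1))) =
      (dcoef n : ℂ) * Z (n - 1) + (dcoef (n + 1) : ℂ) * Z (n + 1) := by
  rw [dcoef_succ_eq, dcoef_eq n]
  push_cast
  ring

/-- Each half-line leaves one decaying exponential. Continuity turns almost everywhere equality into
equality up to the origin, where the two constants must agree. -/
theorem IsWWith.eq_mul_exp {s : ℂ} (hs : 0 < s.re) {u g : ℝ → ℂ} (h : IsWWith u g)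
    (hg : g =ᵐ[volume] fun x => s ^ 2 * u x) (x : ℝ) :
    u x = u 0 * Complex.exp (-s * (|x| : ℝ)) := by
  obtain ⟨hu, hL, hR⟩ := h
  have hg' : g =ᵐ[volume] fun x => (-s) ^ 2 * u x := by simpa only [neg_sq] using hg
  obtain ⟨a, ha⟩ := hR.exists_ae_eq_exp isOpen_Ioi ordConnected_Ioi subset_rfl measurableSet_Ioi
    Real.volume_Ioi (fun x hx => mul_nonneg hs.le (le_of_lt hx)) (ae_restrict_of_ae hg)
  obtain ⟨b, hb⟩ := hL.exists_ae_eq_exp isOpen_Iio ordConnected_Iio subset_rfl measurableSet_Iio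
    Real.volume_Iio (s := -s) (fun x hx => by
      rw [Complex.neg_re]
      exact mul_nonneg_of_nonpos_of_nonpos (neg_nonpos.2 hs.le) (le_of_lt hx))
    (ae_restrict_of_ae hg')
  have hcont : ∀ c t : ℂ, Continuous fun x : ℝ => c * Complex.exp (t * x) := fun c t => by fun_prop
  have ha' := (Measure.eqOn_open_of_ae_eq ha isOpen_Ioi hu.continuousOn
    (hcont _ _).continuousOn).closure hu (hcont _ _)
  have hb' := (Measure.eqOn_open_of_ae_eq hb isOpen_Iio hu.continuousOn
    (hcont _ _).continuousOn).closure hu (hcont _ _)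
  rw [closure_Ioi] at ha'
  rw [closure_Iio] at hb'
  have ha0 : u 0 = a := by simpa using ha' self_mem_Ici
  have hb0 : u 0 = b := by simpa using hb' self_mem_Iic
  rcases le_total 0 x with hx | hx
  · rw [ha' (mem_Ici.2 hx), abs_of_nonneg hx, ha0]
  · rw [hb' (mem_Iic.2 hx), abs_of_nonpos hx, hb0]
    push_cast
    ring_nf

theorem HasDerivJump.eq_of_mul_eta {Λ : ℂ} {n : ℕ} {X j : ℂ}
    (h : HasDerivJump (fun x => X * eta Λ n x) j) : j = -2 * zeta Λ n * qcoef n * X := by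
  obtain ⟨a, b, ha, hb, rfl⟩ := h
  rw [(uniqueDiffWithinAt_Ioi 0).eq_deriv _ ha ((hasDerivWithinAt_eta_Ioi Λ n).const_mul X),
    (uniqueDiffWithinAt_Iio 0).eq_deriv _ hb ((hasDerivWithinAt_eta_Iio Λ n).const_mul X)]
  ring

/-- The components are multiples `X_n η_n`, and the matching conditions say that the Jacobi matrix
annihilates `X`. -/
theorem opA_eq_zero {α : ℝ} (hα : 0 < α) {Λ : ℂ} (hΛ : Λ.im ≠ 0) {U : GH}
    (h : (U, Λ • U) ∈ (opA α).graph) : U = 0 := by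
  rw [opA_graph] at h
  obtain ⟨u, g, h⟩ := h
  set X : ℕ → ℂ := fun n => u n 0 / qcoef n with hX
  have hq : ∀ n, (qcoef n : ℂ) ≠ 0 := fun n => by exact_mod_cast (qcoef_pos n).ne'
  have hu0 : ∀ n, u n 0 = X n * qcoef n := fun n => (div_mul_cancel₀ _ (hq n)).symm
  have hu : ∀ n, u n = fun x => X n * eta Λ n x := fun n => by
    obtain ⟨h1, h2, -, h4⟩ := h n
    have h5 : ((Λ • U n : L2R) : ℝ → ℂ) =ᵐ[volume] fun x => Λ * u n x := by
      filter_upwards [Lp.coeFn_smul Λ (U n), h1] with x hx1 hx2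
      rw [hx1, Pi.smul_apply, smul_eq_mul, hx2]
    funext x
    rw [h2.eq_mul_exp (zeta_re_pos hΛ n) (ae_eq_zeta_sq_mul h5 h4) x, hu0, eta_eq, mul_assoc]
  have hU : ∀ n, U n = X n • etaLp hΛ n := fun n => by
    apply Lp.ext
    filter_upwards [(h n).1, Lp.coeFn_smul (X n) (etaLp hΛ n), (memLp_eta hΛ n).coeFn_toLp]
      with x h1 h2 h3
    refine h1.trans ?_
    rw [h2, Pi.smul_apply, etaLp, h3, hu n, smul_eq_mul]
  have hXm : Memℓp X 2 := by
    -- Chosen so that `1 ≤ K ‖η_n‖`; the lower bound is on the squared norm, hence the second root.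
    set K : ℝ := √(√(1 + 2 * ‖Λ‖))
    refine ((lp.memℓp U).const_smul (K : ℂ)).mono' fun n => ?_
    rw [Pi.smul_apply, norm_smul, Complex.norm_real, Real.norm_of_nonneg (Real.sqrt_nonneg _), hU,
      norm_smul, mul_left_comm]
    refine le_mul_of_one_le_right (norm_nonneg _) ?_
    have h1 := le_norm_etaLp hΛ n
    rw [inv_le_iff_one_le_mul₀ (by positivity)] at h1
    refine le_of_sq_le_sq ?_ (by positivity)
    rw [mul_pow, Real.sq_sqrt (by positivity)]
    linarith
  have hX0 : (⟨X, hXm⟩ : ell2) = 0 := by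
    refine jacobi_eq_zero hΛ (μ := √2 / α) (by positivity) fun n => ?_
    change jacobiAction _ X n = 0
    obtain ⟨-, -, ⟨j, hj, hm⟩, -⟩ := h n
    rw [hu n] at hj
    rw [hj.eq_of_mul_eta, hu0, hu0] at hm
    rw [jacobiAction, ← qcoef_mul_matching, ← hm, ycoef_eq]
    ring
  refine lp.ext (funext fun n => ?_)
  have : X n = 0 := congrArg (fun Z : ell2 => Z n) hX0
  rw [hU, this, zero_smul]
  rfl

theorem isBoundedInverse_opA {α : ℝ} (hα : 0 < α) {μ : ℝ} (hμ : μ = √2 / α) {Λ : ℂ}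
    (hΛ : Λ.im ≠ 0) {R₀ : GH →L[ℂ] GH} {Jinv Yinv : ell2 →L[ℂ] ell2}
    (hR₀ : ∀ f n, (R₀ f n : ℝ → ℂ) =ᵐ[volume] freeSol (zeta Λ n) (f n))
    (hJ : IsBoundedInverse (opJ Λ μ) Jinv) (hY : ∀ F n, Yinv F n = F n / (2 * ycoef Λ n)) :
    IsBoundedInverse (shiftOp (opA α) Λ) (R₀ + opT hΛ ∘L ((μ : ℂ) • Jinv - Yinv) ∘L
      ContinuousLinearMap.adjoint (opT (im_conj_ne_zero hΛ))) := by
  refine isBoundedInverse_shiftOp (fun f => ?_) fun U => opA_eq_zero hα hΛ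
  set F : ell2 := ContinuousLinearMap.adjoint (opT (im_conj_ne_zero hΛ)) f with hF
  set Z : ell2 := Jinv F with hZ
  set X : ell2 := (μ : ℂ) • Z - Yinv F with hX
  have hXn : ∀ n, X n = μ * Z n - F n / (2 * ycoef Λ n) := fun n => by
    rw [← hY]
    rfl
  have hFn : ∀ n, F n = 2 * zeta Λ n * qcoef n * freeSol (zeta Λ n) (f n) 0 :=
    adjoint_opT_apply hΛ f
  have hJZ : ∀ n, jacobiAction (fun n => 2 * (μ : ℂ) * ycoef Λ n) Z n = F n := fun n => by
    obtain ⟨h1, h2⟩ := hJ.1 F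
    exact congrArg (fun Z : ell2 => Z n) h2
  change (R₀ f + opT hΛ X, f + Λ • (R₀ f + opT hΛ X)) ∈ (opA α).graph
  set w : ℕ → ℝ → ℂ := fun n => freeSol (zeta Λ n) (f n) with hw
  set u : ℕ → ℝ → ℂ := fun n => w n + X n • eta Λ n with hu
  have hq : ∀ n, (qcoef n : ℂ) ≠ 0 := fun n => by exact_mod_cast (qcoef_pos n).ne'
  have hz := zeta_ne_zero hΛ
  -- Since `F_n / (2 y_n) = w_n(0) / q_n`, the term `-(2Y)⁻¹ F` exactly cancels the trace of the
  -- free solution.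
  have hu0 : ∀ n, u n 0 = μ * Z n * qcoef n := fun n => by
    have := hq n
    have := hz n
    change w n 0 + X n * eta Λ n 0 = _
    rw [hXn, hFn, eta_zero, ycoef_eq]
    field_simp
    ring
  have hU : ∀ n, ((R₀ f + opT hΛ X : GH) n : ℝ → ℂ) =ᵐ[volume] u n := fun n => by
    filter_upwards [Lp.coeFn_add (R₀ f n) (opT hΛ X n), hR₀ f n, opT_apply hΛ X n] with x h1 h2 h3
    refine h1.trans ?_
    rw [Pi.add_apply, h2, h3]
    rfl
  rw [opA_graph]
  refine ⟨u, fun n x => zeta Λ n ^ 2 * u n x - f n x, fun n => ⟨hU n, ?_, ?_, ?_⟩⟩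
  · have hH := isH2With_freeSol (zeta_re_pos hΛ n) (Lp.memLp (f n))
    have h1 : IsWWith (w n) fun x => zeta Λ n ^ 2 * w n x - f n x :=
      ⟨continuous_freeSol (zeta_re_pos hΛ n) (Lp.memLp (f n)), hH.mono (subset_univ _),
        hH.mono (subset_univ _)⟩
    convert h1.add ((isWWith_eta hΛ n).smul (X n)) using 1
    funext x
    simp only [hu, Pi.add_apply, Pi.smul_apply, smul_eq_mul]
    ring
  · have hd := hasDerivAt_freeSol (zeta_re_pos hΛ n) (Lp.memLp (f n)) 0
    refine ⟨-2 * zeta Λ n * qcoef n * X n, ⟨_, _,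
      hd.hasDerivWithinAt.add ((hasDerivWithinAt_eta_Ioi Λ n).const_smul (X n)),
      hd.hasDerivWithinAt.add ((hasDerivWithinAt_eta_Iio Λ n).const_smul (X n)), ?_⟩, ?_⟩
    · simp only [smul_eq_mul]
      ring
    · rw [← hμ]
      -- After multiplication by `q_n` the left side is `-2 μ y_n X_n = μ F_n - 2 μ² y_n Z_n`, and
      -- the condition is `μ` times the `n`-th row of `J Z = F`.
      refine mul_left_cancel₀ (hq n) ?_
      rw [hu0, hu0, qcoef_mul_matching (fun n => μ * Z n), hXn]
      have h1 := hJZ n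
      rw [jacobiAction] at h1
      have h2 : F n / (2 * ycoef Λ n) * (2 * ycoef Λ n) = F n :=
        div_mul_cancel₀ _ (mul_ne_zero two_ne_zero (ycoef_ne_zero hΛ n))
      linear_combination (μ : ℂ) * h2 - (μ : ℂ) * h1 + 2 * (μ : ℂ) *
        (μ * Z n - F n / (2 * ycoef Λ n)) * ycoef_eq Λ n
  · filter_upwards [hU n, Lp.coeFn_add (f n) (Λ • (R₀ f + opT hΛ X) n),
      Lp.coeFn_smul Λ ((R₀ f + opT hΛ X) n)] with x h1 h2 h3
    refine h2.trans ?_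
    rw [Pi.add_apply, h3, Pi.smul_apply, smul_eq_mul, h1, zeta_sq]
    ring

end Smilansky

end

/-! ### The resolvent formula. -/

theorem theorem7p1 (α : ℝ) (hα : 0 < α) (μ : ℝ) (hμ : μ = √2 / α) (Λ : ℂ) (hΛ : Λ.im ≠ 0) :
    ∃ (Rα R₀ : Smilansky.GH →L[ℂ] Smilansky.GH)
      (Jinv Yinv : Smilansky.ell2 →L[ℂ] Smilansky.ell2),
      Smilansky.IsBoundedInverse (Smilansky.shiftOp (Smilansky.opA α) Λ) Rα ∧
      Smilansky.IsBoundedInverse (Smilansky.shiftOp Smilansky.opA0 Λ) R₀ ∧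
      Smilansky.IsBoundedInverse (Smilansky.opJ Λ μ) Jinv ∧
      Smilansky.IsBoundedInverse ((2 : ℂ) • Smilansky.opY Λ) Yinv ∧
      Rα - R₀ =
        Smilansky.opT hΛ ∘L ((μ : ℂ) • Jinv - Yinv) ∘L
          ContinuousLinearMap.adjoint (Smilansky.opT (Smilansky.im_conj_ne_zero hΛ)) := by
  obtain ⟨R₀, hR₀, hR₀f⟩ := Smilansky.exists_inverse_opA0 hΛ
  obtain ⟨Jinv, hJ⟩ := Smilansky.exists_inverse_opJ hΛ (μ := μ) (by rw [hμ]; positivity)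
  obtain ⟨Yinv, hY, hYf⟩ := Smilansky.exists_inverse_two_opY hΛ
  -- The identity holds by the choice of `Rα`; the content is that this operator inverts `A_α - Λ`.
  -- Nothing is lost, as a two-sided inverse is unique.
  refine ⟨R₀ + Smilansky.opT hΛ ∘L ((μ : ℂ) • Jinv - Yinv) ∘L
    ContinuousLinearMap.adjoint (Smilansky.opT (Smilansky.im_conj_ne_zero hΛ)), R₀,
    Jinv, Yinv, ?_, hR₀, hJ, hY, add_sub_cancel_left _ _⟩
  exact Smilansky.isBoundedInverse_opA hα hμ hΛ hR₀f hJ hYf
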